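/- **Theorem (First variation formula).** Let $(X,d,\ll,\le,\tau)$ be a strongly causal, locally causally closed and regular Lorentzian pre-length space. Let $K\in\mathbb R$, and let $U\subseteq X$ be a $(\le K)$- or a $(\ge K)$-comparison neighbourhood, in the sense of timelike triangle comparison with the model space $\mathbb L^2(K)$ of constant curvature $K$. Let $\delta>0$, let $\gamma\colon[0,\delta]\to U$ be a future-directed timelike geodesic parametrized by $\tau$-arclength, put $a:=\gamma(0)$, and let $p\in X$ be timelike related to $a$. Write $\tau_s(x,y):=\max\{\tau(x,y),\tau(y,x)\}$ and $l(t):=\tau_s(p,\gamma(t))$, and assume $l(0)<\infty$. Let $t_n\in(0,\delta]$ with $t_n\to0$, and let $\beta_{t_n}\colon[0,1]\to X$ be timelike geodesics from $p$ to $\gamma(t_n)$ that converge uniformly (with respect to $d$) to a timelike geodesic $\beta_0\colon[0,1]\to X$ from $p$ to $a$. Let $$\measuredangle_a(\gamma,\beta_0):=\limsup_{s,r\searrow0}\widetilde{\measuredangle}^{K}_a(\gamma(s),\beta_0(1-r)),$$ where $\widetilde{\measuredangle}^{K}_a(x,y)$ is the hyperbolic angle at the vertex corresponding to $a$ of a comparison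 triangle in $\mathbb L^2(K)$ for $a,x,y$, and only those $s,r$ are considered for which it is defined; let the signed angle $\measuredangle^S_a(\gamma,\beta_0)$ be $-\measuredangle_a(\gamma,\beta_0)$ if $\gamma$ and $\beta_0$, as curves starting at $a$, have the same time orientation, and $\measuredangle_a(\gamma,\beta_0)$ otherwise. If $\measuredangle^S_a(\gamma,\beta_0)$ exists (that is, the upper limit is a limit) and is finite, then $l(t_n)<\infty$ for all large $n$ and $$\lim_{n\to\infty}\frac{l(t_n)-l(0)}{t_n}=\sigma\cosh\big(\measuredangle_a(\gamma,\beta_0)\big),\qquad \sigma:=\begin{cases}+1&\text{if }p\ll a,\\-1&\text{if }a\ll p.\end{cases}$$ -/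

import Mathlib

open Filter Topology Set
open scoped ENNReal

namespace LorentzPL

/-- A Lorentzian pre-length space `(X, d, ≪, ≤, τ)` over the metric space `(X, d)`:
`causal` is the relation `≤`, `chron` is `≪`, and `tau` is the time separation function. -/
class LorentzianPreLengthSpace (X : Type*) [MetricSpace X] where
  causal : X → X → Prop
  chron : X → X → Prop
  tau : X → X → ℝ≥0∞
  causal_refl : ∀ x, causal x x
  causal_trans : ∀ x y z, causal x y → causal y z → causal x z
  chron_trans : ∀ x y z, chron x y → chron y z → chron x z
  causal_of_chron : ∀ x y, chron x y → causal x y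
  lowerSemicontinuous_tau : LowerSemicontinuous (fun q : X × X => tau q.1 q.2)
  tau_add_le : ∀ x y z, causal x y → causal y z → tau x y + tau y z ≤ tau x z
  tau_eq_zero : ∀ x y, ¬ causal x y → tau x y = 0
  tau_pos_iff : ∀ x y, 0 < tau x y ↔ chron x y

section Space

variable {X : Type*} [MetricSpace X] [LorentzianPreLengthSpace X]

/-- The causal relation `x ≤ y`. -/
def Caus (x y : X) : Prop := LorentzianPreLengthSpace.causal x y

/-- The chronological (timelike) relation `x ≪ y`. -/
def Chron (x y : X) : Prop := LorentzianPreLengthSpace.chron x y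

/-- The time separation function `τ`. -/
def tau (x y : X) : ℝ≥0∞ := LorentzianPreLengthSpace.tau x y

/-- The order independent time separation `τ_s(x, y) = max (τ(x, y)) (τ(y, x))`. -/
noncomputable def tauS (x y : X) : ℝ≥0∞ := max (tau x y) (tau y x)

/-- The chronological diamond `I(x, y) = I⁺(x) ∩ I⁻(y)`. -/
def diamond (x y : X) : Set X := {z | Chron x z ∧ Chron z y}

variable (X) in
/-- Strong causality: the metric topology is the Alexandrov topology, which has the chronological
diamonds as a subbase. -/
def StronglyCausal : Prop :=
  (inferInstance : TopologicalSpace X) =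
    TopologicalSpace.generateFrom {S : Set X | ∃ x y : X, S = diamond x y}

variable (X) in
/-- Every point has a neighbourhood on whose closure the causal relation is closed. -/
def LocallyCausallyClosed : Prop :=
  ∀ x : X, ∃ V ∈ 𝓝 x, IsClosed ({q : X × X | Caus q.1 q.2} ∩ closure V ×ˢ closure V)

/-- A future-directed causal curve on `[c, d]`. -/
def IsCausalCurve (α : ℝ → X) (c d : ℝ) : Prop :=
  ContinuousOn α (Icc c d) ∧
    ∀ s ∈ Icc c d, ∀ t ∈ Icc c d, s ≤ t → Caus (α s) (α t)

/-- The `τ`-length of the restriction of `α` to `[c, d]`: the infimum, over the partitions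
`c = u 0 ≤ u 1 ≤ ⋯ ≤ u (n + 1) = d`, of the sums of the time separations. -/
noncomputable def tauLength (α : ℝ → X) (c d : ℝ) : ℝ≥0∞ :=
  ⨅ (n : ℕ) (u : ℕ → ℝ) (_ : Monotone u) (_ : u 0 = c) (_ : u (n + 1) = d),
    ∑ i ∈ Finset.range (n + 1), tau (α (u i)) (α (u (i + 1)))

/-- A future-directed (causal) geodesic on `[c, d]`. -/
def IsFutureGeodesic (α : ℝ → X) (c d : ℝ) : Prop :=
  IsCausalCurve α c d ∧
    ∀ s ∈ Icc c d, ∀ t ∈ Icc c d, s ≤ t → tau (α s) (α t) = tauLength α s t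

/-- A future-directed timelike geodesic on `[c, d]`. -/
def IsFutureTimelikeGeodesic (α : ℝ → X) (c d : ℝ) : Prop :=
  IsFutureGeodesic α c d ∧ ∀ s ∈ Icc c d, ∀ t ∈ Icc c d, s < t → Chron (α s) (α t)

/-- A timelike geodesic on `[c, d]`, future-directed or past-directed; the latter means that the
reversed curve is future-directed. -/
def IsTimelikeGeodesic (α : ℝ → X) (c d : ℝ) : Prop :=
  IsFutureTimelikeGeodesic α c d ∨ IsFutureTimelikeGeodesic (fun s => α (c + d - s)) c d

/-- `α` is a future-directed geodesic from `x` to `y`, defined on `[0, 1]`. -/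
def IsGeodesicFromTo (α : ℝ → X) (x y : X) : Prop :=
  IsFutureGeodesic α 0 1 ∧ α 0 = x ∧ α 1 = y

variable (X) in
/-- Regularity: a geodesic between timelike related points contains no null segment. (Causal curves
may be constant on subintervals; a constant piece is not a null segment.) -/
def Regular : Prop :=
  ∀ (x y : X) (α : ℝ → X), Chron x y → IsGeodesicFromTo α x y →
    ∀ s ∈ Icc (0 : ℝ) 1, ∀ t ∈ Icc (0 : ℝ) 1, s < t → α s ≠ α t → Chron (α s) (α t)

end Space

section Model

/-- The model space `𝕃²(K)`, the simply connected Lorentzian surface of constant curvature `K`, in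
global coordinates `(t, x)` in which the metric is conformal to `-dt² + dx²`: the Minkowski plane
for `K = 0`; for `K > 0` the universal cover of de Sitter space, with metric
`(-dt² + dx²) / (K cos² t)` on `|t| < π / 2`; for `K < 0` the universal cover of anti-de Sitter
space, with metric `(-dt² + dx²) / (-K cos² x)` on `|x| < π / 2`. -/
def Model (K : ℝ) : Type :=
  {q : ℝ × ℝ // (0 < K → |q.1| < Real.pi / 2) ∧ (K < 0 → |q.2| < Real.pi / 2)}

/-- The timelike diameter `D_K` of the model space: `π / √(-K)` if `K < 0`, and `∞` otherwise. -/
noncomputable def diamK (K : ℝ) : ℝ≥0∞ :=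
  if K < 0 then ENNReal.ofReal (Real.pi / √(-K)) else ⊤

/-- The ambient scalar product on `ℝ³`, of signature `(-,+,+)` for `K ≥ 0` and `(-,-,+)` for
`K < 0`. -/
noncomputable def ambientForm (K : ℝ) (v w : Fin 3 → ℝ) : ℝ :=
  if K < 0 then -(v 0 * w 0) - v 1 * w 1 + v 2 * w 2
  else -(v 0 * w 0) + v 1 * w 1 + v 2 * w 2

/-- The local isometry of `𝕃²(K)` into `ℝ³`. For `K ≠ 0` it is the covering of the
quadric `⟨v, v⟩ = 1 / K`, for `K = 0` the inclusion of a plane. -/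
noncomputable def embed (K : ℝ) (q : Model K) : Fin 3 → ℝ :=
  if K = 0 then ![q.1.1, q.1.2, 0]
  else if 0 < K then
    (1 / √K) • ![Real.tan q.1.1, Real.cos q.1.2 / Real.cos q.1.1,
      Real.sin q.1.2 / Real.cos q.1.1]
  else
    (1 / √(-K)) • ![Real.cos q.1.1 / Real.cos q.1.2, Real.sin q.1.1 / Real.cos q.1.2,
      Real.tan q.1.2]

/-- The causal relation of the model space. -/
def modelCaus (K : ℝ) (p q : Model K) : Prop := |q.1.2 - p.1.2| ≤ q.1.1 - p.1.1

open Classical in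
/-- The time separation function of the model space. For `K < 0`, points beyond the reach of the
geodesics from `p` but in its causal future are at infinite time separation, since causal curves
from `p` to them can stay arbitrarily close to the conformal boundary for some time. -/
noncomputable def modelTau (K : ℝ) (p q : Model K) : ℝ≥0∞ :=
  if modelCaus K p q then
    if K = 0 then
      ENNReal.ofReal √(-(ambientForm K (embed K q - embed K p) (embed K q - embed K p)))
    else if 0 < K then
      ENNReal.ofReal (Real.arcosh (K * ambientForm K (embed K p) (embed K q)) / √K)
    else if q.1.1 - p.1.1 ≤ Real.pi - |p.1.2 + q.1.2| then
      ENNReal.ofReal (Real.arccos (K * ambientForm K (embed K p) (embed K q)) / √(-K))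
    else ⊤
  else 0

/-- A positive multiple of the initial velocity, at `p`, of the geodesic of the model space from `p`
to `q` (for `p`, `q` timelike related at time separation less than `D_K`), as a vector of `ℝ³`. -/
noncomputable def initialDir (K : ℝ) (p q : Model K) : Fin 3 → ℝ :=
  if K = 0 then embed K q - embed K p
  else embed K q - (K * ambientForm K (embed K p) (embed K q)) • embed K p

/-- The hyperbolic angle at `p` between the geodesics of the model space from `p` to `q` and from
`p` to `r`: the inverse hyperbolic cosine of `|⟨v, w⟩| / (|v| |w|)` for their initial directions
`v`, `w`. -/
noncomputable def modelAngle (K : ℝ) (p q r : Model K) : ℝ :=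
  Real.arcosh (|ambientForm K (initialDir K p q) (initialDir K p r)| /
    (√|ambientForm K (initialDir K p q) (initialDir K p q)| *
      √|ambientForm K (initialDir K p r) (initialDir K p r)|))

end Model

section Comparison

variable {X : Type*} [MetricSpace X] [LorentzianPreLengthSpace X]

/-- `x`, `y` are timelike related, in one or the other order. -/
def TimelikeRelated (x y : X) : Prop := Chron x y ∨ Chron y x

/-- `x'`, `y'`, `z'` are the vertices of a comparison triangle in `𝕃²(K)` for the pairwise timelike
related points `x`, `y`, `z`: same side lengths and time orientations, all sides being shorter than
`D_K`. -/
def IsComparisonTriangle (K : ℝ) (x y z : X) (x' y' z' : Model K) : Prop :=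
  (TimelikeRelated x y ∧ TimelikeRelated y z ∧ TimelikeRelated x z) ∧
  (tauS x y < diamK K ∧ tauS y z < diamK K ∧ tauS x z < diamK K) ∧
  (modelTau K x' y' = tau x y ∧ modelTau K y' x' = tau y x) ∧
  (modelTau K y' z' = tau y z ∧ modelTau K z' y' = tau z y) ∧
  (modelTau K x' z' = tau x z ∧ modelTau K z' x' = tau z x)

/-- `p'` is the comparison point, on the side from `x'` to `y'`, of the point `p` on a geodesic from
`x` to `y`: it lies on the geodesic from `x'` to `y'`, at the same time separation from the ends. -/
def IsComparisonPoint (K : ℝ) (x y p : X) (x' y' p' : Model K) : Prop :=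
  modelCaus K x' p' ∧ modelCaus K p' y' ∧
    modelTau K x' p' = tau x p ∧ modelTau K p' y' = tau p y

/-- A timelike triangle `x ≪ y ≪ z` with sides the given geodesics, all of them in `U`. -/
structure IsTimelikeTriangleIn (U : Set X) (x y z : X) (xy yz xz : ℝ → X) : Prop where
  chron_xy : Chron x y
  chron_yz : Chron y z
  side_xy : IsGeodesicFromTo xy x y
  side_yz : IsGeodesicFromTo yz y z
  side_xz : IsGeodesicFromTo xz x z
  xy_mem : ∀ s ∈ Icc (0 : ℝ) 1, xy s ∈ U
  yz_mem : ∀ s ∈ Icc (0 : ℝ) 1, yz s ∈ U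
  xz_mem : ∀ s ∈ Icc (0 : ℝ) 1, xz s ∈ U

/-- The point `p` lies on one of the sides of the triangle, and `p'` is a comparison point for it on
the corresponding side of the comparison triangle. -/
def OnSides (K : ℝ) (x y z : X) (xy yz xz : ℝ → X) (x' y' z' : Model K)
    (p : X) (p' : Model K) : Prop :=
  (p ∈ xy '' Icc 0 1 ∧ IsComparisonPoint K x y p x' y' p') ∨
  (p ∈ yz '' Icc 0 1 ∧ IsComparisonPoint K y z p y' z' p') ∨
  (p ∈ xz '' Icc 0 1 ∧ IsComparisonPoint K x z p x' z' p')

/-- Triangle comparison in `U` where `R (τ(p, q)) (τ(p', q'))` is required for the points `p`, `q`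
on the sides of a timelike triangle and their comparison points `p'`, `q'`. -/
def TriangleComparison (R : ℝ≥0∞ → ℝ≥0∞ → Prop) (K : ℝ) (U : Set X) : Prop :=
  ∀ (x y z : X) (xy yz xz : ℝ → X), IsTimelikeTriangleIn U x y z xy yz xz →
    ∀ x' y' z' : Model K, IsComparisonTriangle K x y z x' y' z' →
      ∀ (p q : X) (p' q' : Model K),
        OnSides K x y z xy yz xz x' y' z' p p' → OnSides K x y z xy yz xz x' y' z' q q' →
          R (tau p q) (modelTau K p' q')

/-- The conditions on a comparison neighbourhood other than triangle comparison: it is open, `τ` is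
continuous on the set of pairs in it with `τ < D_K`, which is open, and such pairs, if timelike
related, are joined by a geodesic in it. -/
def IsComparisonDomain (K : ℝ) (U : Set X) : Prop :=
  IsOpen U ∧
  IsOpen {q : X × X | q.1 ∈ U ∧ q.2 ∈ U ∧ tau q.1 q.2 < diamK K} ∧
  ContinuousOn (fun q : X × X => tau q.1 q.2)
    {q : X × X | q.1 ∈ U ∧ q.2 ∈ U ∧ tau q.1 q.2 < diamK K} ∧
  ∀ x ∈ U, ∀ y ∈ U, Chron x y → tau x y < diamK K →
    ∃ α : ℝ → X, IsGeodesicFromTo α x y ∧ ∀ s ∈ Icc (0 : ℝ) 1, α s ∈ U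

/-- `U` is a `(≥ K)`-comparison neighbourhood. -/
def IsComparisonNhdGE (K : ℝ) (U : Set X) : Prop :=
  IsComparisonDomain K U ∧ TriangleComparison (fun r r' => r ≤ r') K U

/-- `U` is a `(≤ K)`-comparison neighbourhood. -/
def IsComparisonNhdLE (K : ℝ) (U : Set X) : Prop :=
  IsComparisonDomain K U ∧ TriangleComparison (fun r r' => r ≥ r') K U

/-- The comparison angle at `x` of the points `x`, `y`, `z` is defined. -/
def ComparisonAngleDefined (K : ℝ) (x y z : X) : Prop :=
  ∃ w : Model K × Model K × Model K, IsComparisonTriangle K x y z w.1 w.2.1 w.2.2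

open Classical in
/-- The comparison angle at `x`: the angle at the vertex corresponding to `x` of a comparison
triangle, which is unique up to isometry. -/
noncomputable def comparisonAngle (K : ℝ) (x y z : X) : ℝ :=
  if h : ComparisonAngleDefined K x y z then
    modelAngle K h.choose.1 h.choose.2.1 h.choose.2.2
  else 0

/-- `s, t → 0⁺` through the pairs for which the comparison angle at `α 0` of `α s`, `β t` is
defined. -/
def angleFilter (K : ℝ) (α β : ℝ → X) : Filter (ℝ × ℝ) :=
  (𝓝[>] 0 ×ˢ 𝓝[>] 0) ⊓ 𝓟 {q | ComparisonAngleDefined K (α 0) (α q.1) (β q.2)}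

/-- The angle at `α 0 = β 0` between the curves `α`, `β`, as an upper limit. -/
noncomputable def angle (K : ℝ) (α β : ℝ → X) : EReal :=
  limsup (fun q : ℝ × ℝ => (comparisonAngle K (α 0) (α q.1) (β q.2) : EReal)) (angleFilter K α β)

/-- The angle exists, that is, the upper limit is a (possibly infinite) limit. -/
def AngleExists (K : ℝ) (α β : ℝ → X) : Prop :=
  Tendsto (fun q : ℝ × ℝ => (comparisonAngle K (α 0) (α q.1) (β q.2) : EReal))
    (angleFilter K α β) (𝓝 (angle K α β))

/-- `α` starts in the future direction. -/
def StartsFuture (α : ℝ → X) : Prop := ∀ᶠ s in 𝓝[>] (0 : ℝ), Chron (α 0) (α s)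

open Classical in
/-- The signed angle: minus the angle for curves of the same time orientation, the angle
otherwise. -/
noncomputable def signedAngle (K : ℝ) (α β : ℝ → X) : EReal :=
  if (StartsFuture α ↔ StartsFuture β) then -angle K α β else angle K α β

end Comparison

end LorentzPL

open LorentzPL

/-! Put `a = γ 0` and `ν = -σ`, so that `p` lies from `a` in the time direction `ν`, and read all
separations in that direction. Let `q = β₀ (1 - r)` be a point of `β₀` near `a`. Separations add up
along geodesics and otherwise satisfy the reverse triangle inequality. Passing from `γ (t n)` to `p`
through `q` bounds `l (t n) - l 0` below by the separation of `γ (t n)` and `q` minus that of `a`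
and `q`. Passing from `a` to `p` through `β n (1 - r)` bounds it above by the same difference with
`β n (1 - r)` in place of `q`. So only points in a small neighbourhood matter, where `τ` is finite
and continuous.

By the hyperbolic law of cosines (`modelMd_pt`) such a difference is, to first order, `t n` times
`-ν` times the hyperbolic cosine of the comparison angle at `a` (`eventually_sd_lt`,
`eventually_lt_sd`). For the fixed point `q` existence of the angle puts this cosine near `cosh ω`
once `r` is small (`AngleExists.exists_hcos_near`), which settles the lower bound.

In the upper bound the point `β n (1 - r)` moves, and existence of the angle says nothing about its
comparison angles; the curvature bound has to control them. Under a lower bound comparison angles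
are monotone along `γ`: the small triangle is compared with a triangle having a fixed vertex on `γ`,
and that one converges as `β n (1 - r)` tends to `q` (`eventually_hcos_le_of_GE`). Under an upper
bound take `y` further along `β₀`. Too large a value of `-ν` times the cosine at `β n (1 - r)` would
make the broken path from `γ (t n)` to `y`, through a point of the geodesic from `a` to `β n (1 -
r)`, longer than the separation of `γ (t n)` and `y` allows (`eventually_hcos_le_of_LE`,
`eventually_le_of_shortcut`).

Both cases rest on `hinge_comparison`. Signed separations and the functions `sn`, `md` treat all
time orientations and all signs of `K` together. -/

namespace LorentzPL

/-! ### Generalized trigonometric functions for all curvatures. -/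

section Trigonometry

theorem curvature_cases (K : ℝ) :
    K = 0 ∨ (∃ k : ℝ, 0 < k ∧ K = k ^ 2) ∨ ∃ k : ℝ, 0 < k ∧ K = -k ^ 2 := by
  rcases lt_trichotomy K 0 with h | h | h
  · exact Or.inr (Or.inr ⟨√(-K), Real.sqrt_pos.2 (by linarith), by
      rw [Real.sq_sqrt (by linarith)]; ring⟩)
  · exact Or.inl h
  · exact Or.inr (Or.inl ⟨√K, Real.sqrt_pos.2 h, by rw [Real.sq_sqrt h.le]⟩)

/-- The generalized sine of curvature `-K`, the solution of `f'' = K f` with `f 0 = 0`,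
`f' 0 = 1`. -/
noncomputable def sn (K s : ℝ) : ℝ :=
  if K = 0 then s else if 0 < K then Real.sinh (√K * s) / √K else Real.sin (√(-K) * s) / √(-K)

/-- The primitive of the generalized sine that vanishes at `0`. -/
noncomputable def md (K s : ℝ) : ℝ :=
  if K = 0 then s ^ 2 / 2 else if 0 < K then (Real.cosh (√K * s) - 1) / K
  else (Real.cos (√(-K) * s) - 1) / K

/-- A length below which triangles in `𝕃²(K)` are small. -/
noncomputable def lenBound (K : ℝ) : ℝ := 1 / (1 + √|K|)

theorem sn_zero_left (s : ℝ) : sn 0 s = s := by simp [sn]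
theorem md_zero_left (s : ℝ) : md 0 s = s ^ 2 / 2 := by simp [md]

theorem sn_sq {k : ℝ} (hk : 0 < k) (s : ℝ) : sn (k ^ 2) s = Real.sinh (k * s) / k := by
  simp [sn, hk.ne', hk, Real.sqrt_sq hk.le]

theorem md_sq {k : ℝ} (hk : 0 < k) (s : ℝ) : md (k ^ 2) s = (Real.cosh (k * s) - 1) / k ^ 2 := by
  simp [md, hk.ne', hk, Real.sqrt_sq hk.le]

theorem not_pos_neg_sq (k : ℝ) : ¬ 0 < -k ^ 2 := by nlinarith [sq_nonneg k]

theorem sn_neg_sq {k : ℝ} (hk : 0 < k) (s : ℝ) : sn (-k ^ 2) s = Real.sin (k * s) / k := by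
  simp only [sn, neg_eq_zero, pow_eq_zero_iff, ne_eq, OfNat.ofNat_ne_zero, not_false_eq_true,
    hk.ne', not_pos_neg_sq, neg_neg, Real.sqrt_sq hk.le, if_false]

theorem md_neg_sq {k : ℝ} (hk : 0 < k) (s : ℝ) :
    md (-k ^ 2) s = (1 - Real.cos (k * s)) / k ^ 2 := by
  simp only [md, neg_eq_zero, pow_eq_zero_iff, ne_eq, OfNat.ofNat_ne_zero, not_false_eq_true,
    hk.ne', not_pos_neg_sq, neg_neg, Real.sqrt_sq hk.le, if_false]
  field_simp
  ring

theorem lenBound_pos (K : ℝ) : 0 < lenBound K := by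
  unfold lenBound; positivity

theorem mul_lt_one_of_lt_lenBound_sq {k s : ℝ} (hk : 0 < k) (h : |s| < lenBound (k ^ 2)) :
    |k * s| < 1 := by
  rw [lenBound, abs_of_pos (by positivity : (0 : ℝ) < k ^ 2), Real.sqrt_sq hk.le,
    lt_div_iff₀ (by positivity)] at h
  rw [abs_mul, abs_of_pos hk]
  nlinarith [abs_nonneg s]

theorem lenBound_neg (K : ℝ) : lenBound (-K) = lenBound K := by simp [lenBound]

theorem mul_lt_one_of_lt_lenBound_neg_sq {k s : ℝ} (hk : 0 < k) (h : |s| < lenBound (-k ^ 2)) :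
    |k * s| < 1 :=
  mul_lt_one_of_lt_lenBound_sq hk (by rwa [lenBound_neg] at h)

theorem md_neg (K s : ℝ) : md K (-s) = md K s := by
  simp [md]

theorem sn_neg (K s : ℝ) : sn K (-s) = -sn K s := by
  simp only [sn, mul_neg, Real.sinh_neg, Real.sin_neg, neg_div]
  split_ifs <;> rfl

theorem md_zero (K : ℝ) : md K 0 = 0 := by simp [md]

theorem sn_zero (K : ℝ) : sn K 0 = 0 := by simp [sn]

/-- The addition theorem of the hyperbolic or ordinary cosine, divided by `K` so that it survives at
`K = 0`. The generalized cosine is `1 + K * md K s`. -/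
theorem md_add (K s t : ℝ) :
    md K (s + t) = md K s + md K t + K * md K s * md K t + sn K s * sn K t := by
  rcases curvature_cases K with rfl | ⟨k, hk, rfl⟩ | ⟨k, hk, rfl⟩
  · simp only [md_zero_left, sn_zero_left]; ring
  · simp only [md_sq hk, sn_sq hk, mul_add, Real.cosh_add]
    field_simp
    ring
  · simp only [md_neg_sq hk, sn_neg_sq hk, mul_add, Real.cos_add]
    field_simp
    ring

theorem md_sub (K s t : ℝ) :
    md K (s - t) = md K s + md K t + K * md K s * md K t - sn K s * sn K t := by
  rw [sub_eq_add_neg, md_add, md_neg, sn_neg]; ring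

theorem hasDerivAt_md (K s : ℝ) : HasDerivAt (md K) (sn K s) s := by
  rcases curvature_cases K with rfl | ⟨k, hk, rfl⟩ | ⟨k, hk, rfl⟩
  · rw [show md 0 = fun s => s ^ 2 / 2 from funext md_zero_left, sn_zero_left]
    exact ((hasDerivAt_pow 2 s).div_const 2).congr_deriv (by norm_num)
  · rw [show md (k ^ 2) = _ from funext (md_sq hk), sn_sq hk]
    refine (((((hasDerivAt_id' s).const_mul k).cosh).sub_const 1).div_const (k ^ 2)).congr_deriv ?_
    simp only [mul_one]
    field_simp
  · rw [show md (-k ^ 2) = _ from funext (md_neg_sq hk), sn_neg_sq hk]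
    refine (((((hasDerivAt_id' s).const_mul k).cos).const_sub 1).div_const (k ^ 2)).congr_deriv ?_
    simp only [mul_one]
    field_simp

theorem hasDerivAt_sn_zero (K : ℝ) : HasDerivAt (sn K) 1 0 := by
  rcases curvature_cases K with rfl | ⟨k, hk, rfl⟩ | ⟨k, hk, rfl⟩
  · rw [show sn 0 = fun s => s from funext sn_zero_left]
    exact hasDerivAt_id 0
  · rw [show sn (k ^ 2) = _ from funext (sn_sq hk)]
    refine ((((hasDerivAt_id' (0 : ℝ)).const_mul k).sinh).div_const k).congr_deriv ?_
    simp [hk.ne']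
  · rw [show sn (-k ^ 2) = _ from funext (sn_neg_sq hk)]
    refine ((((hasDerivAt_id' (0 : ℝ)).const_mul k).sin).div_const k).congr_deriv ?_
    simp [hk.ne']

theorem continuous_md (K : ℝ) : Continuous (md K) :=
  continuous_iff_continuousAt.2 fun s => (hasDerivAt_md K s).continuousAt

theorem continuous_sn (K : ℝ) : Continuous (sn K) := by
  unfold sn
  split_ifs <;> fun_prop

theorem sn_pos {K s : ℝ} (h0 : 0 < s) (h : s < lenBound K) : 0 < sn K s := by
  rcases curvature_cases K with rfl | ⟨k, hk, rfl⟩ | ⟨k, hk, rfl⟩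
  · rwa [sn_zero_left]
  · rw [sn_sq hk]
    exact div_pos (Real.sinh_pos_iff.2 (by positivity)) hk
  · rw [sn_neg_sq hk]
    have := mul_lt_one_of_lt_lenBound_neg_sq hk (s := s) (by rwa [abs_of_pos h0])
    refine div_pos (Real.sin_pos_of_pos_of_lt_pi (by positivity) ?_) hk
    linarith [Real.pi_gt_three, le_abs_self (k * s)]

theorem cs_pos {K s : ℝ} (h : |s| < lenBound K) : 0 < 1 + K * md K s := by
  rcases curvature_cases K with rfl | ⟨k, hk, rfl⟩ | ⟨k, hk, rfl⟩
  · simp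
  · rw [md_sq hk]
    have := Real.cosh_pos (k * s)
    field_simp
    linarith
  · rw [md_neg_sq hk]
    have := Real.cos_pos_of_mem_Ioo (x := k * s) (by
      have := abs_lt.1 (mul_lt_one_of_lt_lenBound_neg_sq hk h)
      constructor <;> linarith [Real.pi_gt_three])
    field_simp
    linarith

theorem sn_sq_eq (K s : ℝ) : sn K s ^ 2 = 2 * md K s + K * md K s ^ 2 := by
  have := md_add K s (-s)
  rw [md_neg, sn_neg, add_neg_cancel, md_zero] at this
  linarith

/-- Short lengths can therefore be compared through `md`, in terms of which the law of cosines needs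
no inverse functions. -/
theorem strictMonoOn_md (K : ℝ) : StrictMonoOn (md K) (Ico 0 (lenBound K)) := by
  refine strictMonoOn_of_deriv_pos (convex_Ico _ _) (continuous_md K).continuousOn fun s hs => ?_
  rw [interior_Ico] at hs
  rw [(hasDerivAt_md K s).deriv]
  exact sn_pos hs.1 hs.2

theorem md_abs (K s : ℝ) : md K |s| = md K s := by
  rcases abs_choice s with h | h <;> rw [h]
  exact md_neg K s

theorem md_le_md {K s t : ℝ} (ht : |t| < lenBound K) (h : |s| ≤ |t|) : md K s ≤ md K t := by
  rw [← md_abs K s, ← md_abs K t]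
  exact (strictMonoOn_md K).monotoneOn ⟨abs_nonneg _, h.trans_lt ht⟩ ⟨abs_nonneg _, ht⟩ h

theorem md_lt_md {K s t : ℝ} (ht : |t| < lenBound K) (h : |s| < |t|) : md K s < md K t := by
  rw [← md_abs K s, ← md_abs K t]
  exact strictMonoOn_md K ⟨abs_nonneg _, h.trans ht⟩ ⟨abs_nonneg _, ht⟩ h

theorem md_nonneg {K s : ℝ} (hs : |s| < lenBound K) : 0 ≤ md K s := by
  rw [← md_zero K]
  exact md_le_md hs (by simp)

theorem md_pos {K s : ℝ} (hs : |s| < lenBound K) (h : s ≠ 0) : 0 < md K s := by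
  rw [← md_zero K]
  exact md_lt_md hs (by simpa using h)

theorem abs_lt_abs_of_md_lt {K s t : ℝ} (hs : |s| < lenBound K) (h : md K s < md K t) :
    |s| < |t| := by
  by_contra! hc
  exact absurd (md_le_md hs hc) (not_le.2 h)

theorem sn_mono {K s t : ℝ} (h0 : 0 ≤ s) (h : s ≤ t) (ht : t < lenBound K) :
    sn K s ≤ sn K t := by
  have h1 : md K s ≤ md K t := md_le_md (by rwa [abs_of_nonneg (h0.trans h)])
    (by rwa [abs_of_nonneg h0, abs_of_nonneg (h0.trans h)])
  have hs := cs_pos (K := K) (s := s) (by rw [abs_of_nonneg h0]; exact h.trans_lt ht)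
  have ht' := cs_pos (K := K) (s := t) (by rwa [abs_of_nonneg (h0.trans h)])
  have hsn : 0 ≤ sn K t := by
    rcases (h0.trans h).eq_or_lt with h2 | h2
    · rw [← h2, sn_zero]
    · exact (sn_pos h2 ht).le
  refine le_of_sq_le_sq ?_ hsn
  rw [sn_sq_eq, sn_sq_eq]
  nlinarith

theorem abs_sn_le {K s t : ℝ} (h : |s| ≤ |t|) (ht : |t| < lenBound K) : |sn K s| ≤ |sn K t| := by
  have key : ∀ u : ℝ, |u| < lenBound K → |sn K u| = sn K |u| := by
    intro u hu
    rcases lt_trichotomy u 0 with h | h | h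
    · rw [abs_of_neg h] at hu ⊢
      have := sn_pos (K := K) (neg_pos.2 h) hu
      rw [sn_neg] at this ⊢
      exact abs_of_neg (by linarith)
    · simp [h, sn_zero]
    · rw [abs_of_pos h] at hu ⊢
      exact abs_of_pos (sn_pos h hu)
  rw [key s (h.trans_lt ht), key t ht]
  exact sn_mono (abs_nonneg _) h ht

theorem exists_md_eq {K m ℓ : ℝ} (h0 : 0 < m) (hℓ : 0 ≤ ℓ) (hm : m ≤ md K ℓ) :
    ∃ d, 0 < d ∧ d ≤ ℓ ∧ md K d = m := by
  obtain ⟨d, hd, hd'⟩ := intermediate_value_Icc hℓ (continuous_md K).continuousOn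
    (show m ∈ Icc (md K 0) (md K ℓ) from ⟨by rw [md_zero]; exact h0.le, hm⟩)
  refine ⟨d, lt_of_le_of_ne hd.1 ?_, hd.2, hd'⟩
  rintro rfl
  rw [md_zero] at hd'
  exact h0.ne hd'

end Trigonometry

/-! ### Time separation in the model space and the ambient scalar product. -/

section ModelSpace

/-- The function of two points of the model space that is `md` of their time separation, if they
are causally related and close to each other. -/
noncomputable def modelMd (K : ℝ) (p q : Model K) : ℝ :=
  if K = 0 then -(ambientForm K (embed K q - embed K p) (embed K q - embed K p)) / 2
  else (K * ambientForm K (embed K p) (embed K q) - 1) / K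

theorem ambientForm_comm (K : ℝ) (v w : Fin 3 → ℝ) : ambientForm K v w = ambientForm K w v := by
  unfold ambientForm
  split_ifs <;> ring

theorem ambientForm_neg_neg (K : ℝ) (v : Fin 3 → ℝ) :
    ambientForm K (-v) (-v) = ambientForm K v v := by
  simp [ambientForm]

theorem modelMd_comm (K : ℝ) (p q : Model K) : modelMd K p q = modelMd K q p := by
  unfold modelMd
  rw [ambientForm_comm K (embed K p), ← neg_sub (embed K p), ambientForm_neg_neg]

theorem modelMd_zero_left (p q : Model 0) :
    modelMd 0 p q = ((q.1.1 - p.1.1) ^ 2 - (q.1.2 - p.1.2) ^ 2) / 2 := by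
  simp [modelMd, ambientForm, embed]
  ring

theorem embed_sq {k : ℝ} (hk : 0 < k) (p : Model (k ^ 2)) :
    embed (k ^ 2) p = (1 / k) • ![Real.tan p.1.1, Real.cos p.1.2 / Real.cos p.1.1,
      Real.sin p.1.2 / Real.cos p.1.1] := by
  simp [embed, hk.ne', hk, Real.sqrt_sq hk.le]

theorem embed_neg_sq {k : ℝ} (hk : 0 < k) (p : Model (-k ^ 2)) :
    embed (-k ^ 2) p = (1 / k) • ![Real.cos p.1.1 / Real.cos p.1.2,
      Real.sin p.1.1 / Real.cos p.1.2, Real.tan p.1.2] := by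
  rw [embed, if_neg (by simp [hk.ne']), if_neg (not_pos_neg_sq k), neg_neg, Real.sqrt_sq hk.le]

theorem ambientForm_sq {k : ℝ} (v w : Fin 3 → ℝ) :
    ambientForm (k ^ 2) v w = -(v 0 * w 0) + v 1 * w 1 + v 2 * w 2 := by
  rw [ambientForm, if_neg (not_lt.2 (sq_nonneg k))]

theorem ambientForm_neg_sq {k : ℝ} (hk : 0 < k) (v w : Fin 3 → ℝ) :
    ambientForm (-k ^ 2) v w = -(v 0 * w 0) - v 1 * w 1 + v 2 * w 2 := by
  rw [ambientForm, if_pos (by nlinarith)]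

theorem modelMd_sq {k : ℝ} (hk : 0 < k) (p q : Model (k ^ 2)) :
    modelMd (k ^ 2) p q = (Real.cos (q.1.2 - p.1.2) - Real.cos (q.1.1 - p.1.1)) /
      (k ^ 2 * (Real.cos p.1.1 * Real.cos q.1.1)) := by
  have hp : Real.cos p.1.1 ≠ 0 :=
    (Real.cos_pos_of_mem_Ioo (abs_lt.1 (p.2.1 (by positivity)))).ne'
  have hq : Real.cos q.1.1 ≠ 0 :=
    (Real.cos_pos_of_mem_Ioo (abs_lt.1 (q.2.1 (by positivity)))).ne'
  rw [modelMd, if_neg (by positivity), embed_sq hk, embed_sq hk, ambientForm_sq]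
  simp [Real.tan_eq_sin_div_cos, Real.cos_sub]
  field_simp
  ring

theorem modelMd_neg_sq {k : ℝ} (hk : 0 < k) (p q : Model (-k ^ 2)) :
    modelMd (-k ^ 2) p q = (Real.cos (q.1.2 - p.1.2) - Real.cos (q.1.1 - p.1.1)) /
      (k ^ 2 * (Real.cos p.1.2 * Real.cos q.1.2)) := by
  have hp : Real.cos p.1.2 ≠ 0 :=
    (Real.cos_pos_of_mem_Ioo (abs_lt.1 (p.2.2 (by nlinarith)))).ne'
  have hq : Real.cos q.1.2 ≠ 0 :=
    (Real.cos_pos_of_mem_Ioo (abs_lt.1 (q.2.2 (by nlinarith)))).ne'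
  rw [modelMd, if_neg (by simp [hk.ne']), embed_neg_sq hk, embed_neg_sq hk, ambientForm_neg_sq hk]
  simp [Real.tan_eq_sin_div_cos, Real.cos_sub]
  field_simp
  ring

/-- The coordinates of `p` are less than `π / 2` in absolute value, for `K ≠ 0`. -/
def Near (K : ℝ) (p : Model K) : Prop :=
  K ≠ 0 → |p.1.1| < Real.pi / 2 ∧ |p.1.2| < Real.pi / 2

theorem abs_le_of_cos_le {a b : ℝ} (ha : |a| < Real.pi) (hb0 : 0 ≤ b) (hb : b ≤ Real.pi)
    (h : Real.cos b ≤ Real.cos a) : |a| ≤ b := by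
  by_contra! hc
  have := Real.strictAntiOn_cos ⟨hb0, hb⟩ ⟨abs_nonneg a, ha.le⟩ hc
  rw [Real.cos_abs] at this
  linarith

/-- For `K ≠ 0`, `modelMd` is a positive multiple of `cos Δx - cos Δt`. `Near` keeps both coordinate
differences below `π` in absolute value, so its sign decides causality; the separation is then read
off by inverting the cosine. -/
theorem modelTau_eq_of_modelMd {K : ℝ} {p q : Model K} (hp : Near K p) (hq : Near K q)
    (ht : p.1.1 ≤ q.1.1) {d : ℝ} (h0 : 0 ≤ d) (hd : d < lenBound K)
    (h : modelMd K p q = md K d) :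
    modelCaus K p q ∧ modelTau K p q = ENNReal.ofReal d := by
  rcases curvature_cases K with rfl | ⟨k, hk, rfl⟩ | ⟨k, hk, rfl⟩
  · have hc : modelCaus 0 p q := by
      rw [modelMd_zero_left, md_zero_left] at h
      exact abs_le_of_sq_le_sq (by nlinarith) (by linarith)
    refine ⟨hc, ?_⟩
    rw [modelTau, if_pos hc, if_pos rfl]
    simp only [modelMd, if_true, md_zero_left] at h
    rw [show -(ambientForm 0 (embed 0 q - embed 0 p) (embed 0 q - embed 0 p)) = d ^ 2 by linarith,
      Real.sqrt_sq h0]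
  · have hk2 : k ^ 2 ≠ 0 := by positivity
    obtain ⟨hp1, hp2⟩ := hp hk2
    obtain ⟨hq1, hq2⟩ := hq hk2
    have hc : modelCaus (k ^ 2) p q := by
      have h1 := md_nonneg (K := k ^ 2) (s := d) (by rwa [abs_of_nonneg h0])
      rw [← h, modelMd_sq hk] at h1
      have hcp := Real.cos_pos_of_mem_Ioo (abs_lt.1 hp1)
      have hcq := Real.cos_pos_of_mem_Ioo (abs_lt.1 hq1)
      rw [abs_lt] at hp1 hp2 hq1 hq2
      refine abs_le_of_cos_le (abs_lt.2 ⟨by linarith, by linarith⟩) (by linarith)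
        (by linarith) ?_
      by_contra! hlt
      have := div_neg_of_neg_of_pos (sub_neg.2 hlt)
        (by positivity : 0 < k ^ 2 * (Real.cos p.1.1 * Real.cos q.1.1))
      linarith
    refine ⟨hc, ?_⟩
    rw [modelTau, if_pos hc, if_neg hk2, if_pos (by positivity), Real.sqrt_sq hk.le]
    rw [modelMd, if_neg hk2, md_sq hk, div_left_inj' hk2] at h
    rw [show k ^ 2 * ambientForm (k ^ 2) (embed (k ^ 2) p) (embed (k ^ 2) q) = Real.cosh (k * d) by
      linarith, Real.arcosh_cosh (by positivity)]
    congr 1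
    field_simp
  · have hk2 : -k ^ 2 ≠ 0 := by simp [hk.ne']
    obtain ⟨hp1, hp2⟩ := hp hk2
    obtain ⟨hq1, hq2⟩ := hq hk2
    have hcp := Real.cos_pos_of_mem_Ioo (abs_lt.1 hp2)
    have hcq := Real.cos_pos_of_mem_Ioo (abs_lt.1 hq2)
    rw [abs_lt] at hp1 hp2 hq1 hq2
    have hc : modelCaus (-k ^ 2) p q := by
      have h1 := md_nonneg (K := -k ^ 2) (s := d) (by rwa [abs_of_nonneg h0])
      rw [← h, modelMd_neg_sq hk] at h1
      refine abs_le_of_cos_le (abs_lt.2 ⟨by linarith, by linarith⟩) (by linarith)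
        (by linarith) ?_
      by_contra! hlt
      have := div_neg_of_neg_of_pos (sub_neg.2 hlt)
        (by positivity : 0 < k ^ 2 * (Real.cos p.1.2 * Real.cos q.1.2))
      linarith
    have hkd := mul_lt_one_of_lt_lenBound_neg_sq hk (s := d) (by rwa [abs_of_nonneg h0])
    have hkd' := (abs_lt.1 hkd).2
    refine ⟨hc, ?_⟩
    -- Subtracting `h3` from `h4` gives `cos Δt + cos (x + x') = (1 + cos (k * d)) cos x cos x'`,
    -- which is positive; this is the reach condition in cosine form.
    have hreach : q.1.1 - p.1.1 ≤ Real.pi - |p.1.2 + q.1.2| := by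
      have h2 := Real.cos_pos_of_mem_Ioo (x := k * d)
        ⟨by linarith [Real.pi_gt_three, (abs_lt.1 hkd).1], by linarith [Real.pi_gt_three]⟩
      have h3 : Real.cos (q.1.2 - p.1.2) - Real.cos (q.1.1 - p.1.1) =
          (1 - Real.cos (k * d)) * (Real.cos p.1.2 * Real.cos q.1.2) := by
        rw [modelMd_neg_sq hk, md_neg_sq hk] at h
        field_simp at h
        linarith
      have h4 : Real.cos (q.1.2 - p.1.2) + Real.cos (p.1.2 + q.1.2) =
          2 * (Real.cos p.1.2 * Real.cos q.1.2) := by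
        rw [Real.cos_sub, Real.cos_add]; ring
      have h5 : 0 < Real.cos p.1.2 * Real.cos q.1.2 := by positivity
      have h6 := abs_le_of_cos_le (a := p.1.2 + q.1.2) (b := Real.pi - (q.1.1 - p.1.1))
        (abs_lt.2 ⟨by linarith, by linarith⟩) (by linarith)
        (by linarith) ?_
      · linarith
      · rw [Real.cos_pi_sub]
        nlinarith
    rw [modelTau, if_pos hc, if_neg hk2, if_neg (not_pos_neg_sq k), if_pos hreach, neg_neg,
      Real.sqrt_sq hk.le]
    rw [modelMd, if_neg hk2, md_neg_sq hk] at h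
    rw [show -k ^ 2 * ambientForm (-k ^ 2) (embed (-k ^ 2) p) (embed (-k ^ 2) q) =
      Real.cos (k * d) by field_simp at h; linarith, Real.arccos_cos (by positivity)
        (by linarith [Real.pi_gt_three])]
    congr 1
    field_simp

/-- No position of the points is assumed: the comparison angle is defined by a chosen triangle that
may lie anywhere in the model space. -/
theorem modelMd_eq_of_modelTau {K : ℝ} {p q : Model K} {d : ℝ} (h0 : 0 < d)
    (hd : d < lenBound K) (h : modelTau K p q = ENNReal.ofReal d) : modelMd K p q = md K d := by
  have hc : modelCaus K p q := by
    by_contra hc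
    rw [modelTau, if_neg hc, eq_comm, ENNReal.ofReal_eq_zero] at h
    linarith
  rw [modelTau, if_pos hc] at h
  have key : ∀ x, ENNReal.ofReal x = ENNReal.ofReal d → x = d := by
    intro x hx
    have hx0 : 0 < x := ENNReal.ofReal_pos.1 (hx ▸ ENNReal.ofReal_pos.2 h0)
    exact (ENNReal.ofReal_eq_ofReal_iff hx0.le h0.le).1 hx
  rcases curvature_cases K with rfl | ⟨k, hk, rfl⟩ | ⟨k, hk, rfl⟩
  · rw [if_pos rfl] at h
    have h1 := key _ h
    rw [modelMd, if_pos rfl, md_zero_left, ← h1, Real.sq_sqrt]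
    exact (Real.sqrt_pos.1 (h1 ▸ h0)).le
  · have hk2 : k ^ 2 ≠ 0 := by positivity
    rw [if_neg hk2, if_pos (by positivity), Real.sqrt_sq hk.le] at h
    have h1 := key _ h
    rw [div_eq_iff hk.ne'] at h1
    rw [modelMd, if_neg hk2, md_sq hk]
    set z := k ^ 2 * ambientForm (k ^ 2) (embed (k ^ 2) p) (embed (k ^ 2) q)
    have hz : 1 ≤ z := by
      by_contra! hz
      -- Outside its natural domain `arcosh` still has the value `log (z + √(z ^ 2 - 1))`, and for
      -- `z < 1` the argument has absolute value at most `1`. A positive separation thus forces `1 ≤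
      -- z`.
      have : Real.arcosh z ≤ 0 := by
        rw [Real.arcosh, ← Real.log_abs]
        refine Real.log_nonpos (abs_nonneg _) (abs_le.2 ?_)
        rcases le_or_gt (-1) z with h2 | h2
        · rw [Real.sqrt_eq_zero_of_nonpos (by nlinarith)]
          constructor <;> linarith
        · have h3 : -z - 1 ≤ √(z ^ 2 - 1) := Real.le_sqrt_of_sq_le (by nlinarith)
          have h4 : √(z ^ 2 - 1) ≤ -z := Real.sqrt_le_iff.2 ⟨by linarith, by nlinarith⟩
          constructor <;> linarith
      nlinarith
    rw [mul_comm k d, ← h1, Real.cosh_arcosh hz]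
  · have hk2 : -k ^ 2 ≠ 0 := by simp [hk.ne']
    rw [if_neg hk2, if_neg (not_pos_neg_sq k)] at h
    split_ifs at h with hr
    · rw [neg_neg, Real.sqrt_sq hk.le] at h
      have h1 := key _ h
      rw [div_eq_iff hk.ne'] at h1
      rw [modelMd, if_neg hk2, md_neg_sq hk]
      set z := -k ^ 2 * ambientForm (-k ^ 2) (embed (-k ^ 2) p) (embed (-k ^ 2) q)
      have hkd := mul_lt_one_of_lt_lenBound_neg_sq hk (s := d) (by rwa [abs_of_pos h0])
      have hz1 : z < 1 := by
        rw [← Real.arccos_pos, h1]; positivity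
      have hz2 : -1 ≤ z := by
        by_contra! hz
        rw [Real.arccos_of_le_neg_one hz.le] at h1
        have := (abs_lt.1 hkd).2
        linarith [Real.pi_gt_three]
      rw [mul_comm k d, ← h1, Real.cos_arccos hz2 hz1.le]
      field_simp
      ring
    · exact absurd h.symm ENNReal.ofReal_ne_top

end ModelSpace

/-! ### Polar coordinates in the model space and the law of cosines. -/

section ModelSpace

/-- The time coordinate of `pt K s η`. -/
noncomputable def ptTime (K s η : ℝ) : ℝ :=
  if K = 0 then s * Real.cosh η
  else if 0 < K then Real.arctan (Real.sinh (√K * s) * Real.cosh η)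
  else Real.arctan (Real.tan (√(-K) * s) * Real.cosh η)

/-- The space coordinate of `pt K s η`. -/
noncomputable def ptSpace (K s η : ℝ) : ℝ :=
  if K = 0 then s * Real.sinh η
  else if 0 < K then Real.arctan (Real.tanh (√K * s) * Real.sinh η)
  else Real.arctan (Real.sin (√(-K) * s) * Real.sinh η)

theorem abs_arctan_lt (x : ℝ) : |Real.arctan x| < Real.pi / 2 :=
  abs_lt.2 ⟨Real.neg_pi_div_two_lt_arctan x, Real.arctan_lt_pi_div_two x⟩

theorem abs_ptTime_lt {K : ℝ} (hK : K ≠ 0) (s η : ℝ) : |ptTime K s η| < Real.pi / 2 := by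
  unfold ptTime
  rw [if_neg hK]
  split_ifs <;> exact abs_arctan_lt _

theorem abs_ptSpace_lt {K : ℝ} (hK : K ≠ 0) (s η : ℝ) : |ptSpace K s η| < Real.pi / 2 := by
  unfold ptSpace
  rw [if_neg hK]
  split_ifs <;> exact abs_arctan_lt _

/-- The point of the model space at signed distance `s` from the origin on the timelike geodesic
of rapidity `η`. -/
noncomputable def pt (K s η : ℝ) : Model K :=
  ⟨(ptTime K s η, ptSpace K s η), fun h => abs_ptTime_lt h.ne' s η,
    fun h => abs_ptSpace_lt h.ne s η⟩

theorem near_pt (K s η : ℝ) : Near K (pt K s η) :=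
  fun h => ⟨abs_ptTime_lt h s η, abs_ptSpace_lt h s η⟩

theorem ptTime_sq {k : ℝ} (hk : 0 < k) (s η : ℝ) :
    ptTime (k ^ 2) s η = Real.arctan (Real.sinh (k * s) * Real.cosh η) := by
  simp [ptTime, hk.ne', hk, Real.sqrt_sq hk.le]

theorem ptTime_neg_sq {k : ℝ} (hk : 0 < k) (s η : ℝ) :
    ptTime (-k ^ 2) s η = Real.arctan (Real.tan (k * s) * Real.cosh η) := by
  rw [ptTime, if_neg (by simp [hk.ne']), if_neg (not_pos_neg_sq k), neg_neg, Real.sqrt_sq hk.le]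

theorem ptSpace_sq {k : ℝ} (hk : 0 < k) (s η : ℝ) :
    ptSpace (k ^ 2) s η = Real.arctan (Real.tanh (k * s) * Real.sinh η) := by
  simp [ptSpace, hk.ne', hk, Real.sqrt_sq hk.le]

theorem ptSpace_neg_sq {k : ℝ} (hk : 0 < k) (s η : ℝ) :
    ptSpace (-k ^ 2) s η = Real.arctan (Real.sin (k * s) * Real.sinh η) := by
  rw [ptSpace, if_neg (by simp [hk.ne']), if_neg (not_pos_neg_sq k), neg_neg, Real.sqrt_sq hk.le]

/-- The arctangents in `ptTime` and `ptSpace` are the conformal coordinates of this point of the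
quadric. -/
theorem embed_pt_sq {k : ℝ} (hk : 0 < k) (s η : ℝ) :
    embed (k ^ 2) (pt (k ^ 2) s η) = (1 / k) • ![Real.sinh (k * s) * Real.cosh η,
      Real.cosh (k * s), Real.sinh (k * s) * Real.sinh η] := by
  rw [embed_sq hk]
  have hc := Real.cosh_pos (k * s)
  have h1 : √(1 + (Real.tanh (k * s) * Real.sinh η) ^ 2) =
      √(1 + (Real.sinh (k * s) * Real.cosh η) ^ 2) / Real.cosh (k * s) := by
    rw [eq_div_iff hc.ne', ← Real.sqrt_sq hc.le, ← Real.sqrt_mul (by positivity),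
      Real.tanh_eq_sinh_div_cosh]
    congr 1
    field_simp
    rw [Real.cosh_sq (k * s), Real.cosh_sq η]
    ring
  have h2 : 0 < √(1 + (Real.sinh (k * s) * Real.cosh η) ^ 2) := by positivity
  simp only [pt, ptTime_sq hk, ptSpace_sq hk, Real.tan_arctan, Real.cos_arctan, Real.sin_arctan, h1]
  rw [Real.tanh_eq_sinh_div_cosh]
  congr 1
  ext i
  fin_cases i <;> simp <;> field_simp

theorem cos_pos_of_lt_lenBound {k s : ℝ} (hk : 0 < k) (hs : |s| < lenBound (-k ^ 2)) :
    0 < Real.cos (k * s) := by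
  have := abs_lt.1 (mul_lt_one_of_lt_lenBound_neg_sq hk hs)
  exact Real.cos_pos_of_mem_Ioo ⟨by linarith [Real.pi_gt_three], by linarith [Real.pi_gt_three]⟩

/-- The length bound makes `cos (k * s)` positive, so that the arctangent of `tan (k * s) * cosh η`
lies on the right branch. -/
theorem embed_pt_neg_sq {k : ℝ} (hk : 0 < k) {s : ℝ} (hs : |s| < lenBound (-k ^ 2)) (η : ℝ) :
    embed (-k ^ 2) (pt (-k ^ 2) s η) = (1 / k) • ![Real.cos (k * s),
      Real.sin (k * s) * Real.cosh η, Real.sin (k * s) * Real.sinh η] := by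
  rw [embed_neg_sq hk]
  have hc := cos_pos_of_lt_lenBound hk hs
  have h1 : √(1 + (Real.tan (k * s) * Real.cosh η) ^ 2) =
      √(1 + (Real.sin (k * s) * Real.sinh η) ^ 2) / Real.cos (k * s) := by
    rw [eq_div_iff hc.ne', ← Real.sqrt_sq hc.le, ← Real.sqrt_mul (by positivity),
      Real.tan_eq_sin_div_cos]
    congr 1
    field_simp
    rw [Real.cosh_sq η, Real.cos_sq' (k * s)]
    ring
  have h2 : 0 < √(1 + (Real.sin (k * s) * Real.sinh η) ^ 2) := by positivity
  simp only [pt, ptTime_neg_sq hk, ptSpace_neg_sq hk, Real.tan_arctan, Real.cos_arctan,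
    Real.sin_arctan, h1]
  rw [Real.tan_eq_sin_div_cos]
  congr 1
  ext i
  fin_cases i <;> simp <;> field_simp

/-- The hyperbolic law of cosines. -/
theorem modelMd_pt {K b s : ℝ} (hb : |b| < lenBound K) (hs : |s| < lenBound K) (ζ η : ℝ) :
    modelMd K (pt K b ζ) (pt K s η) =
      md K b + md K s + K * md K b * md K s - sn K b * sn K s * Real.cosh (η - ζ) := by
  rw [Real.cosh_sub]
  rcases curvature_cases K with rfl | ⟨k, hk, rfl⟩ | ⟨k, hk, rfl⟩
  · rw [modelMd_zero_left]
    simp only [pt, ptTime, ptSpace, if_true, md_zero_left, sn_zero_left]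
    have h1 := Real.cosh_sq η
    have h2 := Real.cosh_sq ζ
    linear_combination (s ^ 2 / 2) * h1 + (b ^ 2 / 2) * h2
  · have hk2 : k ^ 2 ≠ 0 := by positivity
    rw [modelMd, if_neg hk2, embed_pt_sq hk, embed_pt_sq hk, ambientForm_sq]
    simp [md_sq hk, sn_sq hk]
    field_simp
    ring
  · have hk2 : -k ^ 2 ≠ 0 := by simp [hk.ne']
    rw [modelMd, if_neg hk2, embed_pt_neg_sq hk hb, embed_pt_neg_sq hk hs, ambientForm_neg_sq hk]
    simp [md_neg_sq hk, sn_neg_sq hk]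
    field_simp
    ring

theorem ptTime_neg (K s η : ℝ) : ptTime K (-s) η = -ptTime K s η := by
  unfold ptTime
  split_ifs <;> simp [Real.arctan_neg]

theorem tan_lt_tan_of_lt_lenBound {k b s : ℝ} (hk : 0 < k) (hb : |b| < lenBound (-k ^ 2))
    (hs : |s| < lenBound (-k ^ 2)) (h : b < s) : Real.tan (k * b) < Real.tan (k * s) := by
  have h1 := abs_lt.1 (mul_lt_one_of_lt_lenBound_neg_sq hk hb)
  have h2 := abs_lt.1 (mul_lt_one_of_lt_lenBound_neg_sq hk hs)
  refine Real.strictMonoOn_tan ?_ ?_ (mul_lt_mul_of_pos_left h hk) <;>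
    constructor <;> linarith [Real.pi_gt_three]

theorem ptTime_lt_ptTime {K b s : ℝ} (hb : |b| < lenBound K) (hs : |s| < lenBound K) (h : b < s)
    (η : ℝ) : ptTime K b η < ptTime K s η := by
  have hη := Real.cosh_pos η
  rcases curvature_cases K with rfl | ⟨k, hk, rfl⟩ | ⟨k, hk, rfl⟩
  · simp only [ptTime, if_true]
    exact mul_lt_mul_of_pos_right h hη
  · rw [ptTime_sq hk, ptTime_sq hk]
    exact Real.arctan_strictMono (mul_lt_mul_of_pos_right
      (Real.sinh_strictMono (mul_lt_mul_of_pos_left h hk)) hη)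
  · rw [ptTime_neg_sq hk, ptTime_neg_sq hk]
    exact Real.arctan_strictMono (mul_lt_mul_of_pos_right
      (tan_lt_tan_of_lt_lenBound hk hb hs h) hη)

theorem ptTime_le_ptTime_rapidity {K s : ℝ} (h0 : 0 ≤ s) (hs : s < lenBound K) (η : ℝ) :
    ptTime K s 0 ≤ ptTime K s η := by
  have hη := Real.one_le_cosh η
  rcases curvature_cases K with rfl | ⟨k, hk, rfl⟩ | ⟨k, hk, rfl⟩
  · simp only [ptTime, if_true, Real.cosh_zero]
    nlinarith
  · rw [ptTime_sq hk, ptTime_sq hk, Real.cosh_zero]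
    have : 0 ≤ Real.sinh (k * s) := Real.sinh_nonneg_iff.2 (by positivity)
    exact Real.arctan_strictMono.monotone (by nlinarith)
  · rw [ptTime_neg_sq hk, ptTime_neg_sq hk, Real.cosh_zero]
    have h1 := abs_lt.1 (mul_lt_one_of_lt_lenBound_neg_sq hk (s := s) (by rwa [abs_of_nonneg h0]))
    have : 0 ≤ Real.tan (k * s) :=
      Real.tan_nonneg_of_nonneg_of_le_pi_div_two (by positivity) (by linarith [Real.pi_gt_three])
    exact Real.arctan_strictMono.monotone (by nlinarith)

/-- Writing `hm` as an upper bound for `cosh η` gives, for `K = k ^ 2`, `sinh (k * b) * sinh (k * s)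
* cosh η < cosh (k * b) * cosh (k * s) - 1 < sinh (k * b) ^ 2`. Cancelling `sinh (k * b)` compares
the time coordinates; the other curvatures are analogous. -/
theorem ptTime_lt_of_timelike {K b s η : ℝ} (h0 : 0 < s) (h : s < b) (hb : b < lenBound K)
    (hm : 0 < md K b + md K s + K * md K b * md K s - sn K b * sn K s * Real.cosh η) :
    ptTime K s η < ptTime K b 0 := by
  have hη := Real.one_le_cosh η
  have hb0 : 0 < b := h0.trans h
  rcases curvature_cases K with rfl | ⟨k, hk, rfl⟩ | ⟨k, hk, rfl⟩
  · simp only [ptTime, if_true, Real.cosh_zero, md_zero_left, sn_zero_left] at hm ⊢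
    have : b * (s * Real.cosh η) < b * (b * 1) := by nlinarith
    exact lt_of_mul_lt_mul_left this hb0.le
  · rw [ptTime_sq hk, ptTime_sq hk, Real.cosh_zero]
    refine Real.arctan_strictMono ?_
    rw [md_sq hk, md_sq hk, sn_sq hk, sn_sq hk] at hm
    have h1 : Real.cosh (k * s) < Real.cosh (k * b) := by
      rw [Real.cosh_lt_cosh, abs_of_pos (by positivity), abs_of_pos (by positivity)]
      exact mul_lt_mul_of_pos_left h hk
    have h2 : 0 < Real.sinh (k * b) := Real.sinh_pos_iff.2 (by positivity)
    have h3 := Real.cosh_sq (k * b)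
    have h4 := Real.cosh_pos (k * b)
    have h5 : Real.sinh (k * b) * (Real.sinh (k * s) * Real.cosh η) <
        Real.cosh (k * b) * Real.cosh (k * s) - 1 := by
      field_simp at hm
      linarith
    have h6 : Real.sinh (k * b) * (Real.sinh (k * s) * Real.cosh η) <
        Real.sinh (k * b) * (Real.sinh (k * b) * 1) := by nlinarith
    exact lt_of_mul_lt_mul_left h6 h2.le
  · rw [ptTime_neg_sq hk, ptTime_neg_sq hk, Real.cosh_zero]
    refine Real.arctan_strictMono ?_
    rw [md_neg_sq hk, md_neg_sq hk, sn_neg_sq hk, sn_neg_sq hk] at hm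
    have hkb := abs_lt.1 (mul_lt_one_of_lt_lenBound_neg_sq hk (s := b) (by rwa [abs_of_pos hb0]))
    have hks : k * s < k * b := mul_lt_mul_of_pos_left h hk
    have h1 : Real.cos (k * b) < Real.cos (k * s) :=
      Real.strictAntiOn_cos ⟨by positivity, by linarith [Real.pi_gt_three]⟩
        ⟨by positivity, by linarith [Real.pi_gt_three]⟩ hks
    have h2 : 0 < Real.sin (k * b) :=
      Real.sin_pos_of_pos_of_lt_pi (by positivity) (by linarith [Real.pi_gt_three])
    have hcb := cos_pos_of_lt_lenBound hk (s := b) (by rwa [abs_of_pos hb0])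
    have hcs := hcb.trans h1
    have h3 := Real.sin_sq_add_cos_sq (k * b)
    have h5 : Real.sin (k * b) * (Real.sin (k * s) * Real.cosh η) <
        1 - Real.cos (k * b) * Real.cos (k * s) := by
      field_simp at hm
      linarith
    rw [Real.tan_eq_sin_div_cos, Real.tan_eq_sin_div_cos, mul_one, div_mul_eq_mul_div,
      div_lt_div_iff₀ hcs hcb]
    have h6 : Real.sin (k * b) * (Real.sin (k * s) * Real.cosh η * Real.cos (k * b)) <
        Real.sin (k * b) * (Real.sin (k * b) * Real.cos (k * s)) := by
      nlinarith
    exact lt_of_mul_lt_mul_left h6 h2.le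

/-- If `0 ≤ s`, raising the rapidity only raises the time coordinate. If both parameters are
negative, time reflection leads back to the previous case. -/
theorem ptTime_lt_of_timelike' {K b s η : ℝ} (hb : |b| < lenBound K) (hs : |s| < lenBound K)
    (h : b < s)
    (hm : 0 < md K b + md K s + K * md K b * md K s - sn K b * sn K s * Real.cosh η) :
    ptTime K b 0 < ptTime K s η := by
  rcases le_or_gt 0 s with h1 | h1
  · exact (ptTime_lt_ptTime hb hs h 0).trans_le
      (ptTime_le_ptTime_rapidity h1 (by rwa [abs_of_nonneg h1] at hs) η)
  · have := ptTime_lt_of_timelike (K := K) (s := -s) (b := -b) (η := η) (by linarith)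
      (by linarith) (by rwa [abs_of_neg (h.trans h1)] at hb)
      (by rw [md_neg, md_neg, sn_neg, sn_neg]; linarith)
    rw [ptTime_neg, ptTime_neg] at this
    linarith

theorem ptTime_gt_of_timelike' {K b s η : ℝ} (hb : |b| < lenBound K) (hs : |s| < lenBound K)
    (h : s < b)
    (hm : 0 < md K b + md K s + K * md K b * md K s - sn K b * sn K s * Real.cosh η) :
    ptTime K s η < ptTime K b 0 := by
  have := ptTime_lt_of_timelike' (K := K) (b := -b) (s := -s) (η := η) (by rwa [abs_neg])
    (by rwa [abs_neg]) (by linarith) (by rw [md_neg, md_neg, sn_neg, sn_neg]; linarith)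
  rw [ptTime_neg, ptTime_neg] at this
  linarith

/-- `q` is at signed time separation `d` from `p`. -/
def MSD (K : ℝ) (p q : Model K) (d : ℝ) : Prop :=
  modelTau K p q = ENNReal.ofReal d ∧ modelTau K q p = ENNReal.ofReal (-d)

theorem MSD.symm {K : ℝ} {p q : Model K} {d : ℝ} (h : MSD K p q d) : MSD K q p (-d) :=
  ⟨h.2, by rw [neg_neg]; exact h.1⟩

theorem MSD.modelCaus {K : ℝ} {p q : Model K} {d : ℝ} (h : MSD K p q d) (hd : 0 < d) :
    modelCaus K p q := by
  by_contra hc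
  have := h.1
  rw [modelTau, if_neg hc, eq_comm, ENNReal.ofReal_eq_zero] at this
  linarith

theorem MSD.modelMd {K : ℝ} {p q : Model K} {d : ℝ} (h : MSD K p q d) (h0 : d ≠ 0)
    (hd : |d| < lenBound K) : modelMd K p q = md K d := by
  rcases lt_or_gt_of_ne h0 with h1 | h1
  · rw [modelMd_comm, ← md_neg]
    exact modelMd_eq_of_modelTau (by linarith) (by rwa [abs_of_neg h1] at hd) h.2
  · exact modelMd_eq_of_modelTau h1 (by rwa [abs_of_pos h1] at hd) h.1

theorem modelCaus_refl (K : ℝ) (p : Model K) : modelCaus K p p := by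
  simp [modelCaus]

theorem modelTau_eq_zero_of_lt {K : ℝ} {p q : Model K} (h : p.1.1 < q.1.1) :
    modelTau K q p = 0 := by
  rw [modelTau, if_neg]
  intro hc
  have := (abs_nonneg _).trans hc
  linarith

theorem MSD.of_lt {K : ℝ} {p q : Model K} (hp : Near K p) (hq : Near K q) (ht : p.1.1 < q.1.1)
    {d : ℝ} (h0 : 0 < d) (hd : d < lenBound K) (h : LorentzPL.modelMd K p q = md K d) :
    MSD K p q d :=
  ⟨(modelTau_eq_of_modelMd hp hq ht.le h0.le hd h).2, by
    rw [modelTau_eq_zero_of_lt ht, ENNReal.ofReal_of_nonpos (by linarith)]⟩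

theorem modelTau_pt_self {K b : ℝ} (hb : |b| < lenBound K) (η : ℝ) :
    modelTau K (pt K b η) (pt K b η) = 0 := by
  have h : modelMd K (pt K b η) (pt K b η) = md K 0 := by
    rw [modelMd_pt hb hb, sub_self, Real.cosh_zero, md_zero]
    linarith [sn_sq_eq K b]
  rw [(modelTau_eq_of_modelMd (near_pt K b η) (near_pt K b η) le_rfl le_rfl (lenBound_pos K) h).2,
    ENNReal.ofReal_zero]

theorem MSD_pt_hinge_pos {K b s d η : ℝ} (hb : |b| < lenBound K) (hs : |s| < lenBound K)
    (h0 : 0 < d) (hd : d < lenBound K) (hbs : b < s)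
    (h : md K d = md K b + md K s + K * md K b * md K s - sn K b * sn K s * Real.cosh η) :
    MSD K (pt K b 0) (pt K s η) d := by
  have hm := md_pos (K := K) (by rwa [abs_of_pos h0]) h0.ne'
  refine MSD.of_lt (near_pt _ _ _) (near_pt _ _ _) (ptTime_lt_of_timelike' hb hs hbs (h ▸ hm)) h0
    hd ?_
  rw [modelMd_pt hb hs, h, sub_zero]

theorem MSD_pt_hinge_neg {K b s d η : ℝ} (hb : |b| < lenBound K) (hs : |s| < lenBound K)
    (h0 : 0 < d) (hd : d < lenBound K) (hbs : s < b)
    (h : md K d = md K b + md K s + K * md K b * md K s - sn K b * sn K s * Real.cosh η) :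
    MSD K (pt K s η) (pt K b 0) d := by
  have hm := md_pos (K := K) (by rwa [abs_of_pos h0]) h0.ne'
  refine MSD.of_lt (near_pt _ _ _) (near_pt _ _ _) (ptTime_gt_of_timelike' hb hs hbs (h ▸ hm)) h0
    hd ?_
  rw [modelMd_comm, modelMd_pt hb hs, h, sub_zero]

theorem MSD_pt_hinge {K b s d η : ℝ} (hb : |b| < lenBound K) (hs : |s| < lenBound K)
    (h0 : d ≠ 0) (hd : |d| < lenBound K) (hbs : b ≠ s) (hiff : 0 < d ↔ b < s)
    (h : md K d = md K b + md K s + K * md K b * md K s - sn K b * sn K s * Real.cosh η) :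
    MSD K (pt K b 0) (pt K s η) d := by
  rcases lt_or_gt_of_ne h0 with h1 | h1
  · have hsb : s < b := lt_of_le_of_ne (not_lt.1 fun h2 => absurd (hiff.2 h2) (by linarith)) hbs.symm
    rw [abs_of_neg h1] at hd
    rw [← md_neg] at h
    simpa using (MSD_pt_hinge_neg hb hs (by linarith) hd hsb h).symm
  · exact MSD_pt_hinge_pos hb hs h1 (by rwa [abs_of_pos h1] at hd) (hiff.1 h1) h

theorem MSD_pt_ray {K b s η : ℝ} (hb : |b| < lenBound K) (hs : |s| < lenBound K)
    (hd : |s - b| < lenBound K) (hbs : b < s) : MSD K (pt K b η) (pt K s η) (s - b) := by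
  refine MSD.of_lt (near_pt _ _ _) (near_pt _ _ _) (ptTime_lt_ptTime hb hs hbs η)
    (by linarith) (by rwa [abs_of_pos (by linarith)] at hd) ?_
  rw [modelMd_pt hb hs, md_sub, sub_self, Real.cosh_zero]
  ring

theorem pt_zero (K η : ℝ) : pt K 0 η = pt K 0 0 := by
  apply Subtype.ext
  simp [pt, ptTime, ptSpace]

end ModelSpace

/-! ### First and second order expansions of the law of cosines. -/

section Asymptotics

theorem tendsto_sn_div (K c : ℝ) : Tendsto (fun t => sn K (c * t) / t) (𝓝[≠] 0) (𝓝 c) := by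
  have h : HasDerivAt (fun t => sn K (c * t)) c 0 := by
    have h1 : HasDerivAt (sn K) 1 (c * 0) := by rw [mul_zero]; exact hasDerivAt_sn_zero K
    have h2 : HasDerivAt (fun t => c * t) (c * 1) 0 := (hasDerivAt_id' (0 : ℝ)).const_mul c
    exact (h1.comp 0 h2).congr_deriv (by ring)
  refine (hasDerivAt_iff_tendsto_slope_zero.1 h).congr fun t => ?_
  simp [sn_zero, div_eq_inv_mul]

theorem tendsto_md_div (K c : ℝ) : Tendsto (fun t => md K (c * t) / t) (𝓝[≠] 0) (𝓝 0) := by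
  have h : HasDerivAt (fun t => md K (c * t)) 0 0 := by
    have h2 : HasDerivAt (fun t => c * t) (c * 1) 0 := (hasDerivAt_id' (0 : ℝ)).const_mul c
    exact ((hasDerivAt_md K (c * 0)).comp 0 h2).congr_deriv (by simp [sn_zero])
  refine (hasDerivAt_iff_tendsto_slope_zero.1 h).congr fun t => ?_
  simp [md_zero, div_eq_inv_mul]

theorem tendsto_md_mul_zero (K c : ℝ) : Tendsto (fun t => md K (c * t)) (𝓝[≠] 0) (𝓝 0) := by
  have h : Continuous fun t => md K (c * t) := (continuous_md K).comp (continuous_const_mul c)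
  have := h.tendsto 0
  simp only [mul_zero, md_zero] at this
  exact this.mono_left nhdsWithin_le_nhds

theorem tendsto_md_div_sq (K c : ℝ) :
    Tendsto (fun t => md K (c * t) / t ^ 2) (𝓝[≠] 0) (𝓝 (c ^ 2 / 2)) := by
  have h2 : Tendsto (fun t => 2 + K * md K (c * t)) (𝓝[≠] 0) (𝓝 (2 + K * 0)) :=
    ((tendsto_md_mul_zero K c).const_mul K).const_add 2
  rw [mul_zero, add_zero] at h2
  refine (((tendsto_sn_div K c).pow 2).div h2 two_ne_zero).congr' ?_
  filter_upwards [h2.eventually_ne two_ne_zero, self_mem_nhdsWithin] with t h3 h4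
  have h4 : t ≠ 0 := h4
  simp only [Pi.div_apply]
  rw [div_pow, sn_sq_eq, show 2 * md K (c * t) + K * md K (c * t) ^ 2 =
    md K (c * t) * (2 + K * md K (c * t)) by ring, div_right_comm, mul_div_cancel_right₀ _ h3]

variable {ι : Type*} {l : Filter ι}

theorem tendsto_nhdsNE_zero {t : ι → ℝ} (ht : Tendsto t l (𝓝 0)) (ht0 : ∀ᶠ i in l, 0 < t i) :
    Tendsto t l (𝓝[≠] 0) :=
  tendsto_nhdsWithin_iff.2 ⟨ht, ht0.mono fun _ h => h.ne'⟩

/-- The defect of the first order expansion of `md K (R + h * t)`. -/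
theorem tendsto_md_barrier (K κ h : ℝ) {R t : ι → ℝ} {R₀ : ℝ} (hR : Tendsto R l (𝓝 R₀))
    (ht : Tendsto t l (𝓝 0)) (ht0 : ∀ᶠ i in l, 0 < t i) :
    Tendsto (fun i => (md K (R i + h * t i) - (md K (R i) + md K (t i) * (1 + K * md K (R i)) +
      sn K (t i) * sn K (R i) * κ)) / t i) l (𝓝 (sn K R₀ * (h - κ))) := by
  have hT := tendsto_nhdsNE_zero ht ht0
  have hm : Tendsto (fun i => md K (R i)) l (𝓝 (md K R₀)) := ((continuous_md K).tendsto _).comp hR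
  have hs : Tendsto (fun i => sn K (R i)) l (𝓝 (sn K R₀)) := ((continuous_sn K).tendsto _).comp hR
  have h1 := (tendsto_sn_div K h).comp hT
  have h2 := (tendsto_sn_div K 1).comp hT
  have h3 := (tendsto_md_div K h).comp hT
  have h4 := (tendsto_md_div K 1).comp hT
  have key := (((h3.sub h4).mul ((hm.const_mul K).const_add 1)).add (h1.mul hs)).sub
    ((h2.mul hs).mul_const κ)
  rw [show (0 - 0) * (1 + K * md K R₀) + h * sn K R₀ - 1 * sn K R₀ * κ = sn K R₀ * (h - κ) by
    ring] at key
  refine key.congr fun i => ?_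
  simp only [Function.comp_apply, one_mul, md_add]
  ring

theorem eventually_lt_md_add {K κ κ' : ℝ} (hκ : κ < κ') {R t : ι → ℝ} {R₀ : ℝ} (h0 : 0 < R₀)
    (h1 : R₀ < lenBound K) (hR : Tendsto R l (𝓝 R₀))
    (ht : Tendsto t l (𝓝 0)) (ht0 : ∀ᶠ i in l, 0 < t i) :
    ∀ᶠ i in l, md K (R i) + md K (t i) * (1 + K * md K (R i)) + sn K (t i) * sn K (R i) * κ <
      md K (R i + κ' * t i) := by
  have h := (tendsto_md_barrier K κ κ' hR ht ht0).eventually_const_lt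
    (mul_pos (sn_pos h0 h1) (sub_pos.2 hκ))
  filter_upwards [h, ht0] with i hi hti
  linarith [(div_pos_iff_of_pos_right hti).1 hi]

theorem eventually_md_add_lt {K κ κ' : ℝ} (hκ : κ' < κ) {R t : ι → ℝ} {R₀ : ℝ} (h0 : 0 < R₀)
    (h1 : R₀ < lenBound K) (hR : Tendsto R l (𝓝 R₀))
    (ht : Tendsto t l (𝓝 0)) (ht0 : ∀ᶠ i in l, 0 < t i) :
    ∀ᶠ i in l, md K (R i + κ' * t i) <
      md K (R i) + md K (t i) * (1 + K * md K (R i)) + sn K (t i) * sn K (R i) * κ := by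
  have h := (tendsto_md_barrier K κ κ' hR ht ht0).eventually_lt_const
    (mul_neg_of_pos_of_neg (sn_pos h0 h1) (sub_neg.2 hκ))
  filter_upwards [h, ht0] with i hi hti
  rw [div_lt_iff₀ hti] at hi
  linarith

theorem tendsto_add_mul {κ : ℝ} {R t : ι → ℝ} {R₀ : ℝ} (hR : Tendsto R l (𝓝 R₀))
    (ht : Tendsto t l (𝓝 0)) : Tendsto (fun i => R i + κ * t i) l (𝓝 R₀) := by
  simpa using hR.add (ht.const_mul κ)

/-- The third side `A` of a hinge with short side `t` is compared with the linear barrier `R + κ' *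
t` by applying `md`. The base length `R` may vary with the index, as needed for the moving points of
the geodesics. -/
theorem eventually_lt_add_mul {K κ κ' : ℝ} (hκ : κ < κ') {R t A : ι → ℝ} {R₀ : ℝ} (h0 : 0 < R₀)
    (h1 : R₀ < lenBound K) (hR : Tendsto R l (𝓝 R₀))
    (ht : Tendsto t l (𝓝 0)) (ht0 : ∀ᶠ i in l, 0 < t i)
    (hA : ∀ᶠ i in l, |A i| < lenBound K ∧ md K (A i) ≤
      md K (R i) + md K (t i) * (1 + K * md K (R i)) + sn K (t i) * sn K (R i) * κ) :
    ∀ᶠ i in l, A i < R i + κ' * t i := by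
  filter_upwards [hA, eventually_lt_md_add hκ h0 h1 hR ht ht0,
    (tendsto_add_mul (κ := κ') hR ht).eventually_const_lt h0] with i hi hi' hp
  have := abs_lt_abs_of_md_lt hi.1 (hi.2.trans_lt hi')
  rw [abs_of_pos hp] at this
  exact (le_abs_self _).trans_lt this

theorem eventually_add_mul_lt {K κ κ' : ℝ} (hκ : κ' < κ) {R t A : ι → ℝ} {R₀ : ℝ} (h0 : 0 < R₀)
    (h1 : R₀ < lenBound K) (hR : Tendsto R l (𝓝 R₀))
    (ht : Tendsto t l (𝓝 0)) (ht0 : ∀ᶠ i in l, 0 < t i)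
    (hA : ∀ᶠ i in l, 0 ≤ A i ∧
      md K (R i) + md K (t i) * (1 + K * md K (R i)) + sn K (t i) * sn K (R i) * κ ≤
      md K (A i)) :
    ∀ᶠ i in l, R i + κ' * t i < A i := by
  have hlim := tendsto_add_mul (κ := κ') hR ht
  filter_upwards [hA, eventually_md_add_lt hκ h0 h1 hR ht ht0,
    hlim.eventually_const_lt h0, hlim.eventually_lt_const h1] with i hi hi' hp hq
  have := abs_lt_abs_of_md_lt (by rwa [abs_of_pos hp]) (hi'.trans_le hi.2)
  rwa [abs_of_pos hp, abs_of_nonneg hi.1] at this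

/-- Divided by `t ^ 2`, the two sides tend to half the two sides of `hw`: at this scale the hinge is
that of the Minkowski plane. -/
theorem eventually_md_mul_lt {K w Λ κ : ℝ} (hw : w ^ 2 < 1 + Λ ^ 2 + 2 * Λ * κ) {t : ι → ℝ}
    (ht : Tendsto t l (𝓝 0)) (ht0 : ∀ᶠ i in l, 0 < t i) :
    ∀ᶠ i in l, md K (w * t i) < md K (t i) + md K (Λ * t i) * (1 + K * md K (t i)) +
      sn K (t i) * sn K (Λ * t i) * κ := by
  have hT := tendsto_nhdsNE_zero ht ht0
  have h1 := (tendsto_md_div_sq K w).comp hT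
  have h2 := (tendsto_md_div_sq K 1).comp hT
  have h3 := (tendsto_md_div_sq K Λ).comp hT
  have h4 := (tendsto_sn_div K 1).comp hT
  have h5 := (tendsto_sn_div K Λ).comp hT
  have h6 := (tendsto_md_mul_zero K 1).comp hT
  have key := ((h2.add (h3.mul ((h6.const_mul K).const_add 1))).add ((h4.mul h5).mul_const κ)).sub
    h1
  have hev := key.eventually_const_lt (u := 0) (by nlinarith)
  filter_upwards [hev, ht0] with i hi hti
  simp only [Function.comp_apply, one_mul] at hi
  rw [← sub_pos]
  refine (div_pos_iff_of_pos_right (pow_pos hti 2)).1 (hi.trans_eq ?_)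
  ring

/-- The algebraic core of the angle comparison under an upper curvature bound: a point `x` between
the vertices `a` and `q`, at distance `Λ t` from `a`, is compared with a point `y` near the
extension of the side beyond `q`. -/
theorem eventually_le_of_shortcut {K κ κ' Y : ℝ} (hκ : κ < κ')
    (hY0 : 0 < Y) (hY : Y < lenBound K) {t G c e R : ι → ℝ} {R₀ : ℝ} (hR0 : 0 < R₀)
    (hR : Tendsto R l (𝓝 R₀))
    (ht : Tendsto t l (𝓝 0)) (ht0 : ∀ᶠ i in l, 0 < t i)
    (he : Tendsto e l (𝓝 (-1)))
    (hG : ∀ κ'' > κ, ∀ᶠ i in l, G i < Y + κ'' * t i)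
    (hx : ∀ᶠ i in l, ∀ s, t i < s → s < R i →
      0 < md K (t i) + md K s * (1 + K * md K (t i)) + sn K (t i) * sn K s * c i →
      0 < md K Y + md K s * (1 + K * md K Y) + sn K s * sn K Y * e i →
      ∃ Z W, 0 ≤ Z ∧ 0 ≤ W ∧ W < lenBound K ∧ Z + W ≤ G i ∧
        md K (t i) + md K s * (1 + K * md K (t i)) + sn K (t i) * sn K s * c i ≤ md K W ∧
        md K Y + md K s * (1 + K * md K Y) + sn K s * sn K Y * e i ≤ md K Z) :
    ∀ᶠ i in l, c i ≤ κ' := by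
  -- The inequality amounts to `κ ^ 2 < 1 + 2 * Λ * (κ' - κ)`: far out on the scale of `t`, any
  -- excess of the angle term becomes visible.
  obtain ⟨Λ, hΛ1, hΛ⟩ : ∃ Λ : ℝ, 1 < Λ ∧ (κ + Λ) ^ 2 < 1 + Λ ^ 2 + 2 * Λ * κ' := by
    refine ⟨max 2 (κ ^ 2 / (κ' - κ)), by simp, ?_⟩
    have h1 : κ ^ 2 ≤ max 2 (κ ^ 2 / (κ' - κ)) * (κ' - κ) := by
      rw [← div_le_iff₀ (sub_pos.2 hκ)]
      exact le_max_right _ _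
    nlinarith [sq_nonneg κ]
  -- The room `ε` absorbs the first order errors in `G` and in `e`.
  obtain ⟨ε, hε, hεΛ⟩ : ∃ ε : ℝ, 0 < ε ∧ (κ + ε + (1 + ε) * Λ) ^ 2 < 1 + Λ ^ 2 + 2 * Λ * κ' := by
    have hcont : Continuous fun ε : ℝ => (κ + ε + (1 + ε) * Λ) ^ 2 := by fun_prop
    have h1 := (hcont.tendsto 0).eventually_lt_const (u := 1 + Λ ^ 2 + 2 * Λ * κ') (by
      simpa using hΛ)
    have h2 := (h1.filter_mono (nhdsWithin_le_nhds (s := Ioi 0))).and self_mem_nhdsWithin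
    obtain ⟨ε, h3, h4⟩ := h2.exists
    exact ⟨ε, h4, h3⟩
  have hX : Tendsto (fun i => Λ * t i) l (𝓝 0) := by simpa using ht.const_mul Λ
  have hX0 : ∀ᶠ i in l, 0 < Λ * t i := ht0.mono fun i hi => by positivity
  have hYc : Tendsto (fun _ : ι => Y) l (𝓝 Y) := tendsto_const_nhds
  have hw0 : Tendsto (fun i => |(κ + ε + (1 + ε) * Λ) * t i|) l (𝓝 0) := by
    simpa using (ht.const_mul (κ + ε + (1 + ε) * Λ)).abs
  have hlimY := tendsto_add_mul (κ := -(1 + ε)) hYc hX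
  filter_upwards [ht0, hX0, hx, hX.eventually_lt_const (lenBound_pos K),
    hX.eventually_lt hR hR0, eventually_md_mul_lt (K := K) hεΛ ht ht0,
    hG (κ + ε) (by linarith), he.eventually_const_lt (show -(1 + ε / 2) < -1 by linarith),
    eventually_md_add_lt (K := K) (show -(1 + ε) < -(1 + ε / 2) by linarith) hY0 hY hYc hX hX0,
    hlimY.eventually_const_lt hY0, hlimY.eventually_lt_const hY,
    hw0.eventually_lt_const (lenBound_pos K)]
    with i hti hXi hxi hXb hXR hmd hGi hei hZi hp1 hp2 hwt
  -- If `κ' < c i`, then `Z` exceeds `Y - (1 + ε) * Λ * t` and `W` exceeds `(κ + ε + (1 + ε) * Λ) *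
  -- t`, so that `Z + W > Y + (κ + ε) * t`, contrary to `Z + W ≤ G i`.
  by_contra! hc
  have hsnt : 0 < sn K (t i) := sn_pos hti (by nlinarith)
  have hsnX : 0 < sn K (Λ * t i) := sn_pos hXi hXb
  have hsnY : 0 < sn K Y := sn_pos hY0 hY
  have h1 : sn K (t i) * sn K (Λ * t i) * κ' < sn K (t i) * sn K (Λ * t i) * c i := by
    have := mul_pos hsnt hsnX
    nlinarith
  have h2 : sn K (Λ * t i) * sn K Y * (-(1 + ε / 2)) < sn K (Λ * t i) * sn K Y * e i := by
    have := mul_pos hsnX hsnY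
    nlinarith
  have hwb : 0 ≤ md K (Y + -(1 + ε) * (Λ * t i)) := md_nonneg (by rwa [abs_of_pos hp1])
  have hwn := md_nonneg hwt
  obtain ⟨Z, W, hZ0, hW0, hWb, hZW, hW, hZ⟩ := hxi (Λ * t i) (by nlinarith) hXR
    (by linarith) (by linarith)
  have h3 : Y + -(1 + ε) * (Λ * t i) < Z := by
    have := abs_lt_abs_of_md_lt (K := K) (s := Y + -(1 + ε) * (Λ * t i)) (t := Z)
      (by rwa [abs_of_pos hp1]) (by linarith)
    rwa [abs_of_pos hp1, abs_of_nonneg hZ0] at this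
  have h4 := abs_lt_abs_of_md_lt hwt (t := W) (by linarith)
  rw [abs_of_nonneg hW0] at h4
  have h5 := le_abs_self ((κ + ε + (1 + ε) * Λ) * t i)
  linarith

end Asymptotics

/-! ### Angles in the model space from side lengths. -/

section Angles

theorem modelMd_self (K : ℝ) (p : Model K) : modelMd K p p = 0 := by
  rcases curvature_cases K with rfl | ⟨k, hk, rfl⟩ | ⟨k, hk, rfl⟩
  · simp [modelMd_zero_left]
  · simp [modelMd_sq hk]
  · simp [modelMd_neg_sq hk]

theorem ambientForm_sub_smul (K c d : ℝ) (u v w : Fin 3 → ℝ) :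
    ambientForm K (v - c • u) (w - d • u) = ambientForm K v w - d * ambientForm K u v -
      c * ambientForm K u w + c * d * ambientForm K u u := by
  simp only [ambientForm, Pi.sub_apply, Pi.smul_apply, smul_eq_mul]
  split_ifs <;> ring

/-- For `K ≠ 0` the initial direction is the component of `embed K q` orthogonal to `embed K p`, so
the product depends only on products of position vectors. -/
theorem ambientForm_initialDir (K : ℝ) (p q r : Model K) :
    ambientForm K (initialDir K p q) (initialDir K p r) =
      modelMd K q r - modelMd K p q - modelMd K p r - K * modelMd K p q * modelMd K p r := by
  by_cases hK : K = 0
  · subst hK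
    simp only [initialDir, modelMd, if_true, ambientForm, lt_irrefl, if_false, Pi.sub_apply]
    ring
  · have h := modelMd_self K p
    rw [modelMd, if_neg hK, div_eq_zero_iff, or_iff_left hK] at h
    simp only [initialDir, if_neg hK, ambientForm_sub_smul, modelMd]
    have h' : ambientForm K (embed K p) (embed K p) = 1 / K := by
      rw [eq_div_iff hK]; linarith
    rw [h']
    field_simp
    ring

theorem modelAngle_eq {K a b c : ℝ} {p q r : Model K} (hb : modelMd K p q = md K b)
    (hc : modelMd K p r = md K c) (ha : modelMd K q r = md K a) :
    modelAngle K p q r = Real.arcosh (|md K b + md K c + K * md K b * md K c - md K a| /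
      (|sn K b| * |sn K c|)) := by
  have h1 : ambientForm K (initialDir K p q) (initialDir K p q) = -sn K b ^ 2 := by
    rw [ambientForm_initialDir, modelMd_self, hb, sn_sq_eq]; ring
  have h2 : ambientForm K (initialDir K p r) (initialDir K p r) = -sn K c ^ 2 := by
    rw [ambientForm_initialDir, modelMd_self, hc, sn_sq_eq]; ring
  rw [modelAngle, h1, h2, ambientForm_initialDir, ha, hb, hc, abs_neg, abs_neg, abs_sq, abs_sq,
    Real.sqrt_sq_eq_abs, Real.sqrt_sq_eq_abs, ← abs_neg (_ - _ - _ - _)]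
  congr 3
  ring

end Angles

/-! ### Signed separations and comparison triangles. -/

section SignedSeparation

variable {X : Type*} [MetricSpace X] [LorentzianPreLengthSpace X]

theorem tau_pos_iff {x y : X} : 0 < tau x y ↔ Chron x y :=
  LorentzianPreLengthSpace.tau_pos_iff x y

theorem Chron.caus {x y : X} (h : Chron x y) : Caus x y :=
  LorentzianPreLengthSpace.causal_of_chron x y h

theorem Chron.trans {x y z : X} (h : Chron x y) (h' : Chron y z) : Chron x z :=
  LorentzianPreLengthSpace.chron_trans x y z h h'

theorem tau_add_le {x y z : X} (h : Caus x y) (h' : Caus y z) : tau x y + tau y z ≤ tau x z :=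
  LorentzianPreLengthSpace.tau_add_le x y z h h'

/-- `y` is at signed time separation `d` from `x`. -/
def SD (x y : X) (d : ℝ) : Prop :=
  tau x y = ENNReal.ofReal d ∧ tau y x = ENNReal.ofReal (-d)

theorem SD.symm {x y : X} {d : ℝ} (h : SD x y d) : SD y x (-d) :=
  ⟨h.2, by rw [neg_neg]; exact h.1⟩

theorem SD.chron {x y : X} {d : ℝ} (h : SD x y d) (hd : 0 < d) : Chron x y :=
  tau_pos_iff.1 (by rw [h.1]; exact ENNReal.ofReal_pos.2 hd)

theorem SD.chron' {x y : X} {d : ℝ} (h : SD x y d) (hd : d < 0) : Chron y x :=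
  h.symm.chron (by linarith)

theorem SD.timelikeRelated {x y : X} {d : ℝ} (h : SD x y d) (hd : d ≠ 0) : TimelikeRelated x y := by
  rcases lt_or_gt_of_ne hd with h1 | h1
  · exact Or.inr (h.chron' h1)
  · exact Or.inl (h.chron h1)

theorem SD.tauS_eq {x y : X} {d : ℝ} (h : SD x y d) : tauS x y = ENNReal.ofReal |d| := by
  rw [tauS, h.1, h.2, ← ENNReal.ofReal_max]
  rfl

theorem SD.add_le {x y z : X} {u v w : ℝ} (hxy : SD x y u) (hyz : SD y z v) (hxz : SD x z w)
    (hu : 0 < u) (hv : 0 < v) : u + v ≤ w := by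
  have h := tau_add_le (hxy.chron hu).caus (hyz.chron hv).caus
  rw [hxy.1, hyz.1, hxz.1, ← ENNReal.ofReal_add hu.le hv.le] at h
  exact (ENNReal.ofReal_le_ofReal_iff' |>.1 h).resolve_right (by linarith)

/-- The reverse triangle inequality at the vertex `a`. -/
theorem SD.hinge {a v w : X} {b L D : ℝ} (hb : SD a v b) (hL : SD a w L) (hD : SD v w D)
    (hb0 : b ≠ 0) (hL0 : L ≠ 0) (hD0 : D ≠ 0) :
    (0 < D ↔ b < L) ∧ b ≠ L ∧ ((0 < b * L ∧ |D| ≤ |b - L|) ∨ (b * L < 0 ∧ |b - L| ≤ |D|)) := by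
  rcases lt_or_gt_of_ne hb0 with h1 | h1 <;> rcases lt_or_gt_of_ne hL0 with h2 | h2 <;>
    rcases lt_or_gt_of_ne hD0 with h3 | h3
  · have := hD.symm.add_le hb.symm hL.symm (by linarith) (by linarith)
    refine ⟨⟨fun h => by linarith, fun h => by linarith⟩, by linarith, Or.inl
      ⟨mul_pos_of_neg_of_neg h1 h2, ?_⟩⟩
    rw [abs_of_neg h3, abs_of_pos (by linarith)]
    linarith
  · have := hD.add_le hL.symm hb.symm (by linarith) (by linarith)
    refine ⟨⟨fun h => by linarith, fun h => by linarith⟩, by linarith, Or.inl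
      ⟨mul_pos_of_neg_of_neg h1 h2, ?_⟩⟩
    rw [abs_of_pos h3, abs_of_neg (by linarith)]
    linarith
  · have := hb.symm.add_le hL hD (by linarith) (by linarith)
    linarith
  · have := hb.symm.add_le hL hD (by linarith) (by linarith)
    refine ⟨⟨fun h => by linarith, fun h => by linarith⟩, by linarith, Or.inr
      ⟨mul_neg_of_neg_of_pos h1 h2, ?_⟩⟩
    rw [abs_of_pos h3, abs_of_neg (by linarith)]
    linarith
  · have := hL.symm.add_le hb hD.symm (by linarith) (by linarith)
    refine ⟨⟨fun h => by linarith, fun h => by linarith⟩, by linarith, Or.inr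
      ⟨mul_neg_of_pos_of_neg h1 h2, ?_⟩⟩
    rw [abs_of_neg h3, abs_of_pos (by linarith)]
    linarith
  · have := hL.symm.add_le hb hD.symm (by linarith) (by linarith)
    linarith
  · have := hL.add_le hD.symm hb (by linarith) (by linarith)
    refine ⟨⟨fun h => by linarith, fun h => by linarith⟩, by linarith, Or.inl
      ⟨mul_pos h1 h2, ?_⟩⟩
    rw [abs_of_neg h3, abs_of_pos (by linarith)]
    linarith
  · have := hb.add_le hD hL (by linarith) (by linarith)
    refine ⟨⟨fun h => by linarith, fun h => by linarith⟩, by linarith, Or.inl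
      ⟨mul_pos h1 h2, ?_⟩⟩
    rw [abs_of_pos h3, abs_of_neg (by linarith)]
    linarith

/-- The hyperbolic cosine of the angle of a triangle in `𝕃²(K)` at a vertex from which the other
ones have signed separations `b` and `c`, the opposite side being of length `a`. -/
noncomputable def hcos (K b c a : ℝ) : ℝ :=
  (md K b + md K c + K * md K b * md K c - md K a) / (sn K b * sn K c)

theorem sn_ne_zero {K s : ℝ} (hs : |s| < lenBound K) (h : s ≠ 0) : sn K s ≠ 0 := by
  rcases lt_or_gt_of_ne h with h1 | h1
  · have := sn_pos (K := K) (s := -s) (by linarith) (by rwa [abs_of_neg h1] at hs)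
    rw [sn_neg] at this
    linarith
  · exact (sn_pos h1 (by rwa [abs_of_pos h1] at hs)).ne'

theorem sn_mul_sn_pos {K s t : ℝ} (hs : |s| < lenBound K) (ht : |t| < lenBound K)
    (h : 0 < s * t) : 0 < sn K s * sn K t := by
  rcases pos_and_pos_or_neg_and_neg_of_mul_pos h with ⟨h1, h2⟩ | ⟨h1, h2⟩
  · rw [abs_of_pos h1] at hs
    rw [abs_of_pos h2] at ht
    exact mul_pos (sn_pos h1 hs) (sn_pos h2 ht)
  · rw [abs_of_neg h1] at hs
    rw [abs_of_neg h2] at ht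
    have := mul_pos (sn_pos (K := K) (neg_pos.2 h1) hs) (sn_pos (K := K) (neg_pos.2 h2) ht)
    rwa [sn_neg, sn_neg, neg_mul_neg] at this

theorem sn_mul_sn_neg {K s t : ℝ} (hs : |s| < lenBound K) (ht : |t| < lenBound K)
    (h : s * t < 0) : sn K s * sn K t < 0 := by
  have := sn_mul_sn_pos (K := K) (s := -s) (t := t) (by rwa [abs_neg]) ht (by linarith)
  rw [sn_neg] at this
  linarith

theorem md_eq_hcos {K b c a : ℝ} (hb : |b| < lenBound K) (hc : |c| < lenBound K) (hb0 : b ≠ 0)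
    (hc0 : c ≠ 0) : md K a = md K b + md K c + K * md K b * md K c -
      sn K b * sn K c * hcos K b c a := by
  have h1 := sn_ne_zero hb hb0
  have h2 := sn_ne_zero hc hc0
  rw [hcos]
  field_simp
  ring

/-- By `md_sub`, the value `1` corresponds to a third side of length `|b - L|`. The deviation from
it and the sign of the denominator change together, so both orientations give the same inequality.
-/
theorem one_le_hcos_of_abs {K b L D : ℝ} (hbl : |b| < lenBound K) (hLl : |L| < lenBound K)
    (hDl : |D| < lenBound K)
    (h : (0 < b * L ∧ |D| ≤ |b - L|) ∨ (b * L < 0 ∧ |b - L| ≤ |D|)) : 1 ≤ hcos K b L D := by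
  have hsub := md_sub K b L
  rcases h with ⟨h1, h2⟩ | ⟨h1, h2⟩
  · have h3 := sn_mul_sn_pos hbl hLl h1
    have hlt : |b - L| < lenBound K := by
      rw [abs_lt] at hbl hLl ⊢
      rcases pos_and_pos_or_neg_and_neg_of_mul_pos h1 with ⟨h5, h6⟩ | ⟨h5, h6⟩ <;>
        constructor <;> linarith
    have h4 := md_le_md hlt h2
    rw [hcos, le_div_iff₀ h3]
    linarith
  · have h3 := sn_mul_sn_neg hbl hLl h1
    have h4 := md_le_md hDl h2
    rw [hcos, le_div_iff_of_neg h3]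
    linarith

theorem SD.one_le_hcos {K : ℝ} {a v w : X} {b L D : ℝ} (hb : SD a v b) (hL : SD a w L)
    (hD : SD v w D) (hb0 : b ≠ 0) (hL0 : L ≠ 0) (hD0 : D ≠ 0) (hbl : |b| < lenBound K)
    (hLl : |L| < lenBound K) (hDl : |D| < lenBound K) : 1 ≤ hcos K b L D :=
  one_le_hcos_of_abs hbl hLl hDl (hb.hinge hL hD hb0 hL0 hD0).2.2

theorem ofReal_lenBound_lt_diamK {K : ℝ} : ENNReal.ofReal (lenBound K) < diamK K := by
  rw [diamK]
  split_ifs with h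
  · have h1 : 0 < √(-K) := Real.sqrt_pos.2 (by linarith)
    refine (ENNReal.ofReal_lt_ofReal_iff (by positivity)).2 ?_
    rw [lenBound, abs_of_neg h, div_lt_div_iff₀ (by positivity) h1]
    nlinarith [Real.pi_gt_three]
  · exact ENNReal.ofReal_lt_top

theorem SD.tauS_lt_diamK {K : ℝ} {x y : X} {d : ℝ} (h : SD x y d) (hd : |d| < lenBound K) :
    tauS x y < diamK K := by
  rw [h.tauS_eq]
  exact (ENNReal.ofReal_le_ofReal hd.le).trans_lt ofReal_lenBound_lt_diamK

theorem isComparisonTriangle_of_SD {K : ℝ} {x y z : X} {x' y' z' : Model K} {u v w : ℝ}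
    (hu : SD x y u) (hv : SD y z v) (hw : SD x z w) (hu' : MSD K x' y' u) (hv' : MSD K y' z' v)
    (hw' : MSD K x' z' w) (hu0 : u ≠ 0) (hv0 : v ≠ 0) (hw0 : w ≠ 0) (hul : |u| < lenBound K)
    (hvl : |v| < lenBound K) (hwl : |w| < lenBound K) :
    IsComparisonTriangle K x y z x' y' z' := by
  refine ⟨⟨hu.timelikeRelated hu0, hv.timelikeRelated hv0, hw.timelikeRelated hw0⟩,
    ⟨hu.tauS_lt_diamK hul, hv.tauS_lt_diamK hvl, hw.tauS_lt_diamK hwl⟩, ?_, ?_, ?_⟩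
  · rw [hu.1, hu.2]; exact hu'
  · rw [hv.1, hv.2]; exact hv'
  · rw [hw.1, hw.2]; exact hw'

theorem MSD_pt_zero {K b : ℝ} (hb : |b| < lenBound K) (h0 : b ≠ 0) (η : ℝ) :
    MSD K (pt K 0 0) (pt K b η) b := by
  have h00 : |(0 : ℝ)| < lenBound K := by simpa using lenBound_pos K
  rw [← pt_zero K η]
  rcases lt_or_gt_of_ne h0 with h1 | h1
  · have h := MSD_pt_ray (K := K) hb h00 (by simpa using hb) h1 (η := η)
    simpa using h.symm
  · have h := MSD_pt_ray (K := K) h00 hb (by simpa using hb) h1 (η := η)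
    simpa using h

/-- Existence of comparison triangles, with explicit vertices. -/
theorem exists_comparisonTriangle {K : ℝ} {a v w : X} {b L D : ℝ} (hb : SD a v b) (hL : SD a w L)
    (hD : SD v w D) (hb0 : b ≠ 0) (hL0 : L ≠ 0) (hD0 : D ≠ 0) (hbl : |b| < lenBound K)
    (hLl : |L| < lenBound K) (hDl : |D| < lenBound K) :
    ∃ η, Real.cosh η = hcos K b L D ∧ MSD K (pt K 0 0) (pt K b 0) b ∧
      MSD K (pt K 0 0) (pt K L η) L ∧ MSD K (pt K b 0) (pt K L η) D := by
  have h1 := Real.cosh_arcosh (hb.one_le_hcos hL hD hb0 hL0 hD0 hbl hLl hDl)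
  obtain ⟨h2, h3, -⟩ := hb.hinge hL hD hb0 hL0 hD0
  refine ⟨_, h1, MSD_pt_zero hbl hb0 0, MSD_pt_zero hLl hL0 _,
    MSD_pt_hinge hbl hLl hD0 hDl h3 h2 ?_⟩
  rw [h1]
  exact md_eq_hcos hbl hLl hb0 hL0

theorem comparisonAngleDefined_of_SD {K : ℝ} {a v w : X} {b L D : ℝ} (hb : SD a v b)
    (hL : SD a w L) (hD : SD v w D) (hb0 : b ≠ 0) (hL0 : L ≠ 0) (hD0 : D ≠ 0)
    (hbl : |b| < lenBound K) (hLl : |L| < lenBound K) (hDl : |D| < lenBound K) :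
    ComparisonAngleDefined K a v w := by
  obtain ⟨η, -, h1, h2, h3⟩ := exists_comparisonTriangle (K := K) hb hL hD hb0 hL0 hD0 hbl hLl hDl
  exact ⟨(_, _, _), isComparisonTriangle_of_SD hb hD hL h1 h3 h2 hb0 hD0 hL0 hbl hDl hLl⟩

/-- The side lengths determine `modelMd` of all pairs of vertices, hence the angle, whichever
comparison triangle was chosen. -/
theorem cosh_comparisonAngle {K : ℝ} {a v w : X} {b L D : ℝ} (hb : SD a v b)
    (hL : SD a w L) (hD : SD v w D) (hb0 : b ≠ 0) (hL0 : L ≠ 0) (hD0 : D ≠ 0)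
    (hbl : |b| < lenBound K) (hLl : |L| < lenBound K) (hDl : |D| < lenBound K) :
    Real.cosh (comparisonAngle K a v w) = hcos K b L D := by
  have hdef := comparisonAngleDefined_of_SD (K := K) hb hL hD hb0 hL0 hD0 hbl hLl hDl
  obtain ⟨-, -, h1, h2, h3⟩ := hdef.choose_spec
  rw [hb.1, hb.2] at h1
  rw [hD.1, hD.2] at h2
  rw [hL.1, hL.2] at h3
  have hone := hb.one_le_hcos (K := K) hL hD hb0 hL0 hD0 hbl hLl hDl
  rw [comparisonAngle, dif_pos hdef, modelAngle_eq (MSD.modelMd h1 hb0 hbl)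
    (MSD.modelMd h3 hL0 hLl) (MSD.modelMd h2 hD0 hDl), ← abs_mul, ← abs_div]
  change Real.cosh (Real.arcosh |hcos K b L D|) = _
  rw [abs_of_pos (by linarith), Real.cosh_arcosh hone]

end SignedSeparation

/-! ### Triangle comparison for a vertex and a point of the opposite side. -/

section Hinge

variable {X : Type*} [MetricSpace X] [LorentzianPreLengthSpace X]

/-- A set in a comparison neighbourhood in which time separations are small. -/
structure IsSmall (K : ℝ) (U V : Set X) : Prop where
  subset : V ⊆ U
  tau_lt : ∀ x ∈ V, ∀ y ∈ V, tau x y < ENNReal.ofReal (lenBound K)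
  isOpen : IsOpen V

/-- If it were positive, the reverse triangle inequality for `x`, `x`, `x` would give `2 τ ≤ τ`. -/
theorem tau_self_eq_zero_of_ne_top {x : X} (h : tau x x ≠ ⊤) : tau x x = 0 := by
  by_contra h0
  have hc := tau_pos_iff.1 (pos_iff_ne_zero.2 h0)
  have h1 := tau_add_le hc.caus hc.caus
  exact absurd (ENNReal.lt_add_right h h0) (not_lt.2 h1)

theorem tau_eq_zero_of_chron {x y : X} (h : Chron x y) (hx : tau x x = 0) : tau y x = 0 := by
  by_contra h0
  have hc := tau_pos_iff.1 (pos_iff_ne_zero.2 h0)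
  have := tau_pos_iff.2 (h.trans hc)
  rw [hx] at this
  exact lt_irrefl _ this

theorem SD_of_chron {x y : X} (h : Chron x y) (hx : tau x x = 0) (hxy : tau x y ≠ ⊤) :
    0 < (tau x y).toReal ∧ SD x y (tau x y).toReal := by
  have h0 : 0 < (tau x y).toReal := ENNReal.toReal_pos (tau_pos_iff.2 h).ne' hxy
  refine ⟨h0, (ENNReal.ofReal_toReal hxy).symm, ?_⟩
  rw [tau_eq_zero_of_chron h hx, ENNReal.ofReal_of_nonpos (by linarith)]

namespace IsSmall

variable {K : ℝ} {U V : Set X}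

theorem tau_ne_top (hV : IsSmall K U V) {x y : X} (hx : x ∈ V) (hy : y ∈ V) : tau x y ≠ ⊤ :=
  (hV.tau_lt x hx y hy).ne_top

theorem tau_self (hV : IsSmall K U V) {x : X} (hx : x ∈ V) : tau x x = 0 :=
  tau_self_eq_zero_of_ne_top (hV.tau_ne_top hx hx)

theorem tau_lt_diamK (hV : IsSmall K U V) {x y : X} (hx : x ∈ V) (hy : y ∈ V) :
    tau x y < diamK K :=
  (hV.tau_lt x hx y hy).trans ofReal_lenBound_lt_diamK

theorem abs_lt (hV : IsSmall K U V) {x y : X} (hx : x ∈ V) (hy : y ∈ V) {d : ℝ} (h : SD x y d) :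
    |d| < lenBound K := by
  have h1 : tauS x y < ENNReal.ofReal (lenBound K) :=
    max_lt (hV.tau_lt x hx y hy) (hV.tau_lt y hy x hx)
  rwa [h.tauS_eq, ENNReal.ofReal_lt_ofReal_iff (lenBound_pos K)] at h1

end IsSmall

/-- `x` lies on the geodesic `α` in `U` between `a` and `w`, at signed separation `s` from `a`,
the signed separation of `w` from `a` being `L`. -/
def OnSegment (U : Set X) (α : ℝ → X) (a w x : X) (L s : ℝ) : Prop :=
  (∀ u ∈ Icc (0 : ℝ) 1, α u ∈ U) ∧ x ∈ α '' Icc 0 1 ∧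
    ((0 < s ∧ s < L ∧ IsGeodesicFromTo α a w ∧ tau a x = ENNReal.ofReal s ∧
        tau x w = ENNReal.ofReal (L - s)) ∨
      (s < 0 ∧ L < s ∧ IsGeodesicFromTo α w a ∧ tau x a = ENNReal.ofReal (-s) ∧
        tau w x = ENNReal.ofReal (s - L)))

theorem isComparisonPoint_left {K : ℝ} {x y : X} {x' y' : Model K} {u : ℝ} (h : SD x y u)
    (h' : MSD K x' y' u) (hu : 0 < u) (hx : tau x x = 0) (hx' : modelTau K x' x' = 0) :
    IsComparisonPoint K x y x x' y' x' :=
  ⟨modelCaus_refl K x', h'.modelCaus hu, by rw [hx, hx'], by rw [h.1, h'.1]⟩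

theorem isComparisonPoint_right {K : ℝ} {x y : X} {x' y' : Model K} {u : ℝ} (h : SD x y u)
    (h' : MSD K x' y' u) (hu : 0 < u) (hy : tau y y = 0) (hy' : modelTau K y' y' = 0) :
    IsComparisonPoint K x y y x' y' y' :=
  ⟨h'.modelCaus hu, modelCaus_refl K y', by rw [h.1, h'.1], by rw [hy, hy']⟩

theorem IsGeodesicFromTo.left_mem {α : ℝ → X} {x y : X} (h : IsGeodesicFromTo α x y) :
    x ∈ α '' Icc 0 1 := ⟨0, by simp, h.2.1⟩

theorem IsGeodesicFromTo.right_mem {α : ℝ → X} {x y : X} (h : IsGeodesicFromTo α x y) :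
    y ∈ α '' Icc 0 1 := ⟨1, by simp, h.2.2⟩

/-- Existence of the length of the third side of the partial hinge. -/
theorem exists_md_eq_hinge {K b L s D c : ℝ} (hbl : |b| < lenBound K) (hLl : |L| < lenBound K)
    (hDl : |D| < lenBound K) (hs : (0 < s ∧ s < L) ∨ (s < 0 ∧ L < s)) (hb0 : b ≠ 0) (hc : 1 ≤ c)
    (hD : md K D = md K b + md K L + K * md K b * md K L - sn K b * sn K L * c)
    (hm : 0 < md K b + md K s + K * md K b * md K s - sn K b * sn K s * c) :
    ∃ d, 0 < d ∧ d < lenBound K ∧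
      md K d = md K b + md K s + K * md K b * md K s - sn K b * sn K s * c := by
  have hsL : |s| ≤ |L| := by
    rcases hs with ⟨h1, h2⟩ | ⟨h1, h2⟩
    · rw [abs_of_pos h1, abs_of_pos (h1.trans h2)]; exact h2.le
    · rw [abs_of_neg h1, abs_of_neg (h2.trans h1)]; linarith
  have hsl := hsL.trans_lt hLl
  have hs0 : s ≠ 0 := by rcases hs with h | h <;> linarith
  suffices h : ∃ ℓ, 0 ≤ ℓ ∧ ℓ < lenBound K ∧
      md K b + md K s + K * md K b * md K s - sn K b * sn K s * c ≤ md K ℓ by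
    obtain ⟨ℓ, h0, h1, h2⟩ := h
    obtain ⟨d, hd0, hd1, hd2⟩ := exists_md_eq hm h0 h2
    exact ⟨d, hd0, hd1.trans_lt h1, hd2⟩
  -- An upper bound for the intermediate value argument: on opposite time sides of the vertex the
  -- full side `D` is longer than the partial one; on the same side `1 ≤ c` bounds the third side by
  -- `|b - s|`.
  rcases lt_or_gt_of_ne (mul_ne_zero hb0 hs0) with h | h
  · refine ⟨|D|, abs_nonneg _, hDl, ?_⟩
    rw [md_abs, hD]
    have hbL : b * L < 0 := by
      rcases hs with ⟨h1, h2⟩ | ⟨h1, h2⟩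
      · have : b < 0 := by by_contra! h3; nlinarith
        nlinarith
      · have : 0 < b := by by_contra! h3; nlinarith
        nlinarith
    have h1 := sn_mul_sn_neg hbl hsl h
    have h2 := sn_mul_sn_neg hbl hLl hbL
    have h3 : |sn K b * sn K s| ≤ |sn K b * sn K L| := by
      rw [abs_mul, abs_mul]
      exact mul_le_mul_of_nonneg_left (abs_sn_le hsL hLl) (abs_nonneg _)
    rw [abs_of_neg h1, abs_of_neg h2] at h3
    have h4 := md_le_md hLl hsL
    have h5 := cs_pos hbl
    nlinarith
  · refine ⟨|b - s|, abs_nonneg _, ?_, ?_⟩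
    · rw [abs_lt] at hbl hsl ⊢
      rcases pos_and_pos_or_neg_and_neg_of_mul_pos h with ⟨h5, h6⟩ | ⟨h5, h6⟩ <;>
        constructor <;> linarith
    · rw [md_abs, md_sub]
      nlinarith [sn_mul_sn_pos hbl hsl h]

/-- Triangle comparison is applied in both orders, since which order is timelike depends on the
signs of the hinge data. -/
theorem rel_and_swap {A B : Type*} {S : A → B → Prop} {Q : A → A → B → B → Prop}
    (T : ∀ (p q : A) (p' q' : B), S p p' → S q q' → Q p q p' q') {p q : A} {p' q' : B}
    (hp : S p p') (hq : S q q') : Q p q p' q' ∧ Q q p q' p' :=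
  ⟨T p q p' q' hp hq, T q p q' p' hq hp⟩

/-- Comparison of the distance from a vertex to a point of the opposite side. -/
theorem hinge_comparison {R : ℝ≥0∞ → ℝ≥0∞ → Prop} {K : ℝ} {U V : Set X}
    (hU : IsComparisonDomain K U) (hT : TriangleComparison R K U) (hV : IsSmall K U V)
    {a v w : X} (ha : a ∈ V) (hv : v ∈ V) (hw : w ∈ V) {b L D : ℝ} (hb : SD a v b)
    (hL : SD a w L) (hD : SD v w D) (hb0 : b ≠ 0) (hL0 : L ≠ 0) (hD0 : D ≠ 0)
    {α : ℝ → X} {x : X} {s : ℝ} (hx : OnSegment U α a w x L s)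
    (hm : 0 < md K b + md K s + K * md K b * md K s - sn K b * sn K s * hcos K b L D) :
    ∃ d, 0 < d ∧ d < lenBound K ∧
      md K d = md K b + md K s + K * md K b * md K s - sn K b * sn K s * hcos K b L D ∧
      (b < s → R (tau v x) (ENNReal.ofReal d)) ∧ (s < b → R (tau x v) (ENNReal.ofReal d)) := by
  have hbl := hV.abs_lt ha hv hb
  have hLl := hV.abs_lt ha hw hL
  have hDl := hV.abs_lt hv hw hD
  obtain ⟨hαU, hxα, hseg⟩ := hx
  have hs : (0 < s ∧ s < L) ∨ (s < 0 ∧ L < s) :=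
    hseg.imp (fun h => ⟨h.1, h.2.1⟩) (fun h => ⟨h.1, h.2.1⟩)
  have hsl : |s| < lenBound K := by
    rw [abs_lt] at hLl ⊢
    rcases hs with h | h <;> constructor <;> linarith
  have hdiff : |L - s| < lenBound K := by
    rw [abs_lt] at hLl ⊢
    rcases hs with h | h <;> constructor <;> linarith
  have hs0 : s ≠ 0 := by rcases hs with h | h <;> linarith
  obtain ⟨η, hη, ma, mw, mD⟩ := exists_comparisonTriangle (K := K) hb hL hD hb0 hL0 hD0 hbl hLl hDl
  obtain ⟨d, hd0, hdl, hd⟩ := exists_md_eq_hinge hbl hLl hDl hs hb0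
    (hb.one_le_hcos hL hD hb0 hL0 hD0 hbl hLl hDl) (md_eq_hcos hbl hLl hb0 hL0) hm
  obtain ⟨hsign, hbL, -⟩ := hb.hinge hL hD hb0 hL0 hD0
  have mx : MSD K (pt K 0 0) (pt K s η) s := MSD_pt_zero hsl hs0 η
  have h00 : modelTau K (pt K 0 0) (pt K 0 0) = 0 :=
    modelTau_pt_self (by simpa using lenBound_pos K) 0
  have hbb : modelTau K (pt K b 0) (pt K b 0) = 0 := modelTau_pt_self hbl 0
  have side : ∀ {x y : X} {u : ℝ}, x ∈ V → y ∈ V → SD x y u → 0 < u →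
      ∃ α : ℝ → X, IsGeodesicFromTo α x y ∧ ∀ s ∈ Icc (0 : ℝ) 1, α s ∈ U :=
    fun hx hy h hu => hU.2.2.2 _ (hV.subset hx) _ (hV.subset hy) (h.chron hu)
      (hV.tau_lt_diamK hx hy)
  suffices key : R (tau v x) (modelTau K (pt K b 0) (pt K s η)) ∧
      R (tau x v) (modelTau K (pt K s η) (pt K b 0)) by
    refine ⟨d, hd0, hdl, hd, fun h => ?_, fun h => ?_⟩
    · rw [← (MSD_pt_hinge_pos hbl hsl hd0 hdl h (hη ▸ hd)).1]
      exact key.1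
    · rw [← (MSD_pt_hinge_neg hbl hsl hd0 hdl h (hη ▸ hd)).1]
      exact key.2
  have tv := hV.tau_self hv
  -- The signs of `L`, `b` and `b - L` fix the time order of `a`, `v`, `w`. In each of the six
  -- orders `v` is regarded as an endpoint of a side and `x` as a point of the side `α`.
  rcases hseg with ⟨h1, h2, hα, h3, h4⟩ | ⟨h1, h2, hα, h3, h4⟩
  · have hL0' : 0 < L := h1.trans h2
    have mxw : MSD K (pt K s η) (pt K L η) (L - s) := MSD_pt_ray hsl hLl hdiff h2
    have hcx : IsComparisonPoint K a w x (pt K 0 0) (pt K L η) (pt K s η) :=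
      ⟨mx.modelCaus h1, mxw.modelCaus (by linarith), by rw [mx.1, h3], by rw [mxw.1, h4]⟩
    rcases lt_or_gt_of_ne hb0 with hb1 | hb1
    · have hb1' : 0 < -b := by linarith
      have hD1 : 0 < D := hsign.2 (by linarith)
      obtain ⟨xy, hxy, hxyU⟩ := side hv ha hb.symm hb1'
      obtain ⟨xz, hxz, hxzU⟩ := side hv hw hD hD1
      have T := hT v a w xy α xz ⟨hb.symm.chron hb1', hL.chron hL0', hxy, hα, hxz, hxyU, hαU, hxzU⟩
        _ _ _ (isComparisonTriangle_of_SD hb.symm hL hD ma.symm mw mD (by linarith) hL0 hD0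
          (by rwa [abs_neg]) hLl hDl)
      exact rel_and_swap T (Or.inl ⟨hxy.left_mem, isComparisonPoint_left hb.symm ma.symm hb1' tv
        hbb⟩)
        (Or.inr (Or.inl ⟨hxα, hcx⟩))
    · rcases lt_or_gt_of_ne hbL with hb2 | hb2
      · have hD1 : 0 < D := hsign.2 hb2
        obtain ⟨xy, hxy, hxyU⟩ := side ha hv hb hb1
        obtain ⟨yz, hyz, hyzU⟩ := side hv hw hD hD1
        have T := hT a v w xy yz α ⟨hb.chron hb1, hD.chron hD1, hxy, hyz, hα, hxyU, hyzU, hαU⟩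
          _ _ _ (isComparisonTriangle_of_SD hb hD hL ma mD mw hb0 hD0 hL0 hbl hDl hLl)
        exact rel_and_swap T (Or.inl ⟨hxy.right_mem, isComparisonPoint_right hb ma hb1 tv hbb⟩)
          (Or.inr (Or.inr ⟨hxα, hcx⟩))
      · have hD1 : 0 < -D := by
          have := fun h => (hsign.1 h).not_gt hb2
          rcases lt_or_gt_of_ne hD0 with h | h
          · linarith
          · exact absurd h this
        obtain ⟨yz, hyz, hyzU⟩ := side hw hv hD.symm hD1
        obtain ⟨xz, hxz, hxzU⟩ := side ha hv hb hb1
        have T := hT a w v α yz xz ⟨hL.chron hL0', hD.symm.chron hD1, hα, hyz, hxz, hαU, hyzU, hxzU⟩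
          _ _ _ (isComparisonTriangle_of_SD hL hD.symm hb mw mD.symm ma hL0 (by linarith) hb0
            hLl (by rwa [abs_neg]) hbl)
        exact rel_and_swap T (Or.inr (Or.inl ⟨hyz.right_mem,
          isComparisonPoint_right hD.symm mD.symm hD1 tv hbb⟩))
          (Or.inl ⟨hxα, hcx⟩)
  · have hL0' : 0 < -L := by linarith
    have hdiff' : |s - L| < lenBound K := by rwa [abs_sub_comm]
    have mxw : MSD K (pt K L η) (pt K s η) (s - L) := MSD_pt_ray hLl hsl hdiff' h2
    have hcx : IsComparisonPoint K w a x (pt K L η) (pt K 0 0) (pt K s η) :=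
      ⟨mxw.modelCaus (by linarith), mx.symm.modelCaus (by linarith), by rw [mxw.1, h4],
        by rw [mx.symm.1, h3]⟩
    rcases lt_or_gt_of_ne hb0 with hb1 | hb1
    · have hb1' : 0 < -b := by linarith
      rcases lt_or_gt_of_ne hbL with hb2 | hb2
      · have hD1 : 0 < D := hsign.2 hb2
        obtain ⟨xy, hxy, hxyU⟩ := side hv hw hD hD1
        obtain ⟨xz, hxz, hxzU⟩ := side hv ha hb.symm hb1'
        have T := hT v w a xy α xz ⟨hD.chron hD1, hL.symm.chron hL0', hxy, hα, hxz, hxyU, hαU,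
            hxzU⟩
          _ _ _ (isComparisonTriangle_of_SD hD hL.symm hb.symm mD mw.symm ma.symm hD0 (by linarith)
            (by linarith) hDl (by rwa [abs_neg]) (by rwa [abs_neg]))
        exact rel_and_swap T (Or.inl ⟨hxy.left_mem, isComparisonPoint_left hD mD hD1 tv hbb⟩)
          (Or.inr (Or.inl ⟨hxα, hcx⟩))
      · have hD1 : 0 < -D := by
          have := fun h => (hsign.1 h).not_gt hb2
          rcases lt_or_gt_of_ne hD0 with h | h
          · linarith
          · exact absurd h this
        obtain ⟨xy, hxy, hxyU⟩ := side hw hv hD.symm hD1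
        obtain ⟨yz, hyz, hyzU⟩ := side hv ha hb.symm hb1'
        have T := hT w v a xy yz α ⟨hD.symm.chron hD1, hb.symm.chron hb1', hxy, hyz, hα, hxyU, hyzU,
            hαU⟩
          _ _ _ (isComparisonTriangle_of_SD hD.symm hb.symm hL.symm mD.symm ma.symm mw.symm
            (by linarith) (by linarith) (by linarith) (by rwa [abs_neg]) (by rwa [abs_neg])
            (by rwa [abs_neg]))
        exact rel_and_swap T (Or.inl ⟨hxy.right_mem,
          isComparisonPoint_right hD.symm mD.symm hD1 tv hbb⟩)
          (Or.inr (Or.inr ⟨hxα, hcx⟩))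
    · have hD1 : 0 < -D := by
        have := fun h => (hsign.1 h).not_gt (by linarith)
        rcases lt_or_gt_of_ne hD0 with h | h
        · linarith
        · exact absurd h this
      obtain ⟨yz, hyz, hyzU⟩ := side ha hv hb hb1
      obtain ⟨xz, hxz, hxzU⟩ := side hw hv hD.symm hD1
      have T := hT w a v α yz xz ⟨hL.symm.chron hL0', hb.chron hb1, hα, hyz, hxz, hαU, hyzU, hxzU⟩
        _ _ _ (isComparisonTriangle_of_SD hL.symm hb hD.symm mw.symm ma mD.symm (by linarith) hb0
          (by linarith) (by rwa [abs_neg]) hbl (by rwa [abs_neg]))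
      exact rel_and_swap T (Or.inr (Or.inl ⟨hyz.right_mem,
        isComparisonPoint_right hb ma hb1 tv hbb⟩))
        (Or.inl ⟨hxα, hcx⟩)

end Hinge

/-! ### Small neighbourhoods, points on geodesics, and limits of comparison angles. -/

section Local

variable {X : Type*} [MetricSpace X] [LorentzianPreLengthSpace X]

theorem exists_isSmall {K : ℝ} {U : Set X} (hU : IsComparisonDomain K U) {a : X} (ha : a ∈ U)
    (h0 : tau a a = 0) : ∃ V, IsSmall K U V ∧ a ∈ V := by
  obtain ⟨-, hW, hc, -⟩ := hU
  have ho := hc.isOpen_inter_preimage hW (isOpen_Iio (a := ENNReal.ofReal (lenBound K)))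
  have hmem : (a, a) ∈ {q : X × X | q.1 ∈ U ∧ q.2 ∈ U ∧ tau q.1 q.2 < diamK K} ∩
      (fun q : X × X => tau q.1 q.2) ⁻¹' Iio (ENNReal.ofReal (lenBound K)) := by
    have h1 : tau a a < ENNReal.ofReal (lenBound K) := by
      rw [h0]; exact ENNReal.ofReal_pos.2 (lenBound_pos K)
    exact ⟨⟨ha, ha, h1.trans ofReal_lenBound_lt_diamK⟩, h1⟩
  obtain ⟨u, v, hu, hv, hau, hav, huv⟩ := isOpen_prod_iff.1 ho a a hmem
  exact ⟨u ∩ v, ⟨fun x hx => (huv (mk_mem_prod hx.1 hx.2)).1.1,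
    fun x hx y hy => (huv (mk_mem_prod hx.1 hy.2)).2, hu.inter hv⟩, hau, hav⟩

theorem IsComparisonDomain.continuousAt_tau {K : ℝ} {U : Set X} (hU : IsComparisonDomain K U)
    {x y : X} (hx : x ∈ U) (hy : y ∈ U) (h : tau x y < diamK K) :
    ContinuousAt (fun q : X × X => tau q.1 q.2) (x, y) :=
  hU.2.2.1.continuousAt (hU.2.1.mem_nhds ⟨hx, hy, h⟩)

/-- The signed time separation. -/
noncomputable def sd (x y : X) : ℝ := (tau x y).toReal - (tau y x).toReal

theorem SD.sd_eq {x y : X} {d : ℝ} (h : SD x y d) : sd x y = d := by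
  rw [sd, h.1, h.2]
  rcases le_total 0 d with h1 | h1
  · rw [ENNReal.toReal_ofReal h1, ENNReal.ofReal_of_nonpos (by linarith)]; simp
  · rw [ENNReal.ofReal_of_nonpos h1, ENNReal.toReal_ofReal (by linarith)]; simp

theorem sd_comm (x y : X) : sd x y = -sd y x := by simp [sd]

namespace IsSmall

variable {K : ℝ} {U V : Set X}

theorem SD_sd (hV : IsSmall K U V) {x y : X} (hx : x ∈ V) (hy : y ∈ V) : SD x y (sd x y) := by
  by_cases h : Chron x y
  · have := (SD_of_chron h (hV.tau_self hx) (hV.tau_ne_top hx hy)).2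
    rwa [this.sd_eq]
  by_cases h' : Chron y x
  · have := (SD_of_chron h' (hV.tau_self hy) (hV.tau_ne_top hy hx)).2.symm
    rwa [this.sd_eq]
  · rw [← tau_pos_iff, not_lt, nonpos_iff_eq_zero] at h h'
    simp [SD, sd, h, h']

theorem abs_sd_lt (hV : IsSmall K U V) {x y : X} (hx : x ∈ V) (hy : y ∈ V) :
    |sd x y| < lenBound K := hV.abs_lt hx hy (hV.SD_sd hx hy)

theorem tendsto_sd (hV : IsSmall K U V) (hU : IsComparisonDomain K U) {ι : Type*} {l : Filter ι}
    {x y : X} (hx : x ∈ V) (hy : y ∈ V) {f g : ι → X} (hf : Tendsto f l (𝓝 x))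
    (hg : Tendsto g l (𝓝 y)) : Tendsto (fun i => sd (f i) (g i)) l (𝓝 (sd x y)) := by
  have key : ∀ {x y : X} {f g : ι → X}, x ∈ V → y ∈ V → Tendsto f l (𝓝 x) → Tendsto g l (𝓝 y) →
      Tendsto (fun i => (tau (f i) (g i)).toReal) l (𝓝 (tau x y).toReal) := by
    intro x y f g hx hy hf hg
    exact (ENNReal.tendsto_toReal (hV.tau_ne_top hx hy)).comp
      ((hU.continuousAt_tau (hV.subset hx) (hV.subset hy) (hV.tau_lt_diamK hx hy)).tendsto.comp
        (hf.prodMk_nhds hg))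
  exact (key hx hy hf hg).sub (key hy hx hg hf)

end IsSmall

theorem tauLength_le_sum (α : ℝ → X) {c d : ℝ} {n : ℕ} {u : ℕ → ℝ} (hu : Monotone u)
    (h0 : u 0 = c) (hn : u (n + 1) = d) :
    tauLength α c d ≤ ∑ i ∈ Finset.range (n + 1), tau (α (u i)) (α (u (i + 1))) := by
  unfold tauLength
  exact iInf_le_of_le n (iInf_le_of_le u (iInf_le_of_le hu (iInf_le_of_le h0
    (iInf_le_of_le hn le_rfl))))

/-- The partition `c ≤ s ≤ d` bounds the length from above, and the length is the separation of the
ends; the other inequality is the reverse triangle inequality. -/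
theorem IsFutureGeodesic.tau_add {α : ℝ → X} {c d s : ℝ} (h : IsFutureGeodesic α c d)
    (hs : s ∈ Icc c d) : tau (α c) (α s) + tau (α s) (α d) = tau (α c) (α d) := by
  have hcd := hs.1.trans hs.2
  have hc : c ∈ Icc c d := ⟨le_rfl, hcd⟩
  have hd : d ∈ Icc c d := ⟨hcd, le_rfl⟩
  refine le_antisymm (tau_add_le (h.1.2 c hc s hs hs.1) (h.1.2 s hs d hd hs.2)) ?_
  rw [h.2 c hc d hd hcd]
  let u : ℕ → ℝ := fun i => if i = 0 then c else if i = 1 then s else d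
  have hu : Monotone u := by
    refine monotone_nat_of_le_succ fun n => ?_
    rcases n with _ | _ | n
    · simpa [u] using hs.1
    · simpa [u] using hs.2
    · simp [u]
  refine (tauLength_le_sum α (n := 1) hu (by simp [u]) (by simp [u])).trans ?_
  simp [Finset.sum_range_succ, u]

theorem tauLength_le_tau (α : ℝ → X) {c d : ℝ} (h : c ≤ d) :
    tauLength α c d ≤ tau (α c) (α d) := by
  let u : ℕ → ℝ := fun i => if i = 0 then c else d
  have hu : Monotone u := by
    refine monotone_nat_of_le_succ fun n => ?_
    rcases n with _ | n
    · simpa [u] using h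
    · simp [u]
  refine (tauLength_le_sum α (n := 0) hu (by simp [u]) (by simp [u])).trans ?_
  simp [u]

/-- A curve parametrized proportionally to `τ`-arclength is a geodesic. -/
theorem isFutureGeodesic_of_tau_eq {α : ℝ → X} {c d r : ℝ} (hr : 0 ≤ r) (hα : IsCausalCurve α c d)
    (h : ∀ s ∈ Icc c d, ∀ t ∈ Icc c d, s ≤ t →
      tau (α s) (α t) = ENNReal.ofReal (r * (t - s))) : IsFutureGeodesic α c d := by
  refine ⟨hα, fun s hs t ht hst => le_antisymm ?_ (tauLength_le_tau α hst)⟩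
  refine le_iInf fun n => le_iInf fun u => le_iInf fun hu => le_iInf fun hu0 => le_iInf fun hun => ?_
  have hmem : ∀ i ≤ n + 1, u i ∈ Icc c d := fun i hi =>
    ⟨hs.1.trans (hu0 ▸ hu (Nat.zero_le i)), (hun ▸ hu hi : u i ≤ t).trans ht.2⟩
  have h1 : ∑ i ∈ Finset.range (n + 1), tau (α (u i)) (α (u (i + 1))) =
      ∑ i ∈ Finset.range (n + 1), ENNReal.ofReal (r * (u (i + 1) - u i)) := by
    refine Finset.sum_congr rfl fun i hi => ?_
    have hi := Finset.mem_range.1 hi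
    exact h _ (hmem _ (by omega)) _ (hmem _ (by omega)) (hu (Nat.le_succ i))
  rw [h1, ← ENNReal.ofReal_sum_of_nonneg
    (fun i _ => mul_nonneg hr (sub_nonneg.2 (hu (Nat.le_succ i)))), ← Finset.mul_sum,
    Finset.sum_range_sub, hu0, hun, h s hs t ht hst]

theorem isGeodesicFromTo_of_unit_speed {γ : ℝ → X} {δ : ℝ} (hγ : IsCausalCurve γ 0 δ)
    (hγτ : ∀ s ∈ Icc 0 δ, ∀ t ∈ Icc 0 δ, s ≤ t → tau (γ s) (γ t) = ENNReal.ofReal (t - s))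
    {s : ℝ} (hs : s ∈ Icc 0 δ) : IsGeodesicFromTo (fun u => γ (s * u)) (γ 0) (γ s) := by
  have hmaps : ∀ u ∈ Icc (0 : ℝ) 1, s * u ∈ Icc 0 δ := fun u hu =>
    ⟨mul_nonneg hs.1 hu.1, (mul_le_of_le_one_right hs.1 hu.2).trans hs.2⟩
  refine ⟨isFutureGeodesic_of_tau_eq hs.1 ⟨?_, ?_⟩ ?_, by simp, by simp⟩
  · exact hγ.1.comp (by fun_prop) hmaps
  · exact fun u hu v hv huv => hγ.2 _ (hmaps u hu) _ (hmaps v hv)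
      (mul_le_mul_of_nonneg_left huv hs.1)
  · intro u hu v hv huv
    rw [hγτ _ (hmaps u hu) _ (hmaps v hv) (mul_le_mul_of_nonneg_left huv hs.1), mul_sub]

theorem onSegment_of_unit_speed {γ : ℝ → X} {δ : ℝ} {U : Set X} (hγ : IsCausalCurve γ 0 δ)
    (hγτ : ∀ s ∈ Icc 0 δ, ∀ t ∈ Icc 0 δ, s ≤ t → tau (γ s) (γ t) = ENNReal.ofReal (t - s))
    (hγU : ∀ s ∈ Icc 0 δ, γ s ∈ U) {s t : ℝ} (ht : 0 < t) (hts : t < s) (hs : s ≤ δ) :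
    OnSegment U (fun u => γ (s * u)) (γ 0) (γ s) (γ t) s t := by
  have hs0 : 0 < s := ht.trans hts
  have hs' : s ∈ Icc 0 δ := ⟨hs0.le, hs⟩
  have ht' : t ∈ Icc 0 δ := ⟨ht.le, hts.le.trans hs⟩
  refine ⟨fun u hu => hγU _ ⟨mul_nonneg hs0.le hu.1,
    (mul_le_of_le_one_right hs0.le hu.2).trans hs⟩, ⟨t / s, ⟨by positivity,
    (div_le_one hs0).2 hts.le⟩, by simp only [mul_div_cancel₀ _ hs0.ne']⟩,
    Or.inl ⟨ht, hts, isGeodesicFromTo_of_unit_speed hγ hγτ hs', ?_, hγτ t ht' s hs' hts.le⟩⟩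
  rw [hγτ 0 ⟨le_rfl, hs0.le.trans hs⟩ t ht' ht.le, sub_zero]

theorem exists_onSegment {K : ℝ} {U V : Set X} (hU : IsComparisonDomain K U)
    (hV : IsSmall K U V) {a w : X} (ha : a ∈ V) (hw : w ∈ V) {L s : ℝ} (hL : SD a w L)
    (hs : (0 < s ∧ s < L) ∨ (s < 0 ∧ L < s)) : ∃ α x, OnSegment U α a w x L s := by
  have ivt : ∀ {x y : X} {d r : ℝ}, x ∈ V → y ∈ V → SD x y d → 0 < r → r < d →
      ∃ α z, IsGeodesicFromTo α x y ∧ (∀ u ∈ Icc (0 : ℝ) 1, α u ∈ U) ∧ z ∈ α '' Icc 0 1 ∧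
        tau x z = ENNReal.ofReal r ∧ tau z y = ENNReal.ofReal (d - r) := by
    intro x y d r hx hy hd hr hrd
    obtain ⟨α, hα, hαU⟩ := hU.2.2.2 x (hV.subset hx) y (hV.subset hy) (hd.chron (hr.trans hrd))
      (hV.tau_lt_diamK hx hy)
    have hadd : ∀ u ∈ Icc (0 : ℝ) 1, tau x (α u) + tau (α u) y = tau x y := by
      intro u hu
      have := hα.1.tau_add hu
      rwa [hα.2.1, hα.2.2] at this
    have hle : ∀ u ∈ Icc (0 : ℝ) 1, tau x (α u) ≤ tau x y := fun u hu => by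
      rw [← hadd u hu]; exact le_self_add
    have hcont : ContinuousOn (fun u => (tau x (α u)).toReal) (Icc 0 1) := by
      intro u hu
      -- The geodesic stays in `U` but may leave `V`; continuity is still available because `tau x
      -- (α u)` is at most `tau x y`.
      have h1 := hU.continuousAt_tau (hV.subset hx) (hαU u hu)
        ((hle u hu).trans_lt (hV.tau_lt_diamK hx hy))
      have h2 : Tendsto (fun u => (x, α u)) (𝓝[Icc 0 1] u) (𝓝 (x, α u)) :=
        tendsto_const_nhds.prodMk_nhds (hα.1.1.1 u hu)
      exact (ENNReal.tendsto_toReal (ne_top_of_le_ne_top (hV.tau_ne_top hx hy) (hle u hu))).comp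
        (h1.tendsto.comp h2)
    obtain ⟨u, hu, hur⟩ := intermediate_value_Icc zero_le_one hcont
      (show r ∈ Icc _ _ by
        simp only [hα.2.1, hα.2.2, hV.tau_self hx, hd.1]
        rw [ENNReal.toReal_ofReal (by linarith)]
        exact ⟨by simpa using hr.le, hrd.le⟩)
    have hfin := ne_top_of_le_ne_top (hV.tau_ne_top hx hy) (hle u hu)
    have h1 : tau x (α u) = ENNReal.ofReal r := by
      rw [← hur, ENNReal.ofReal_toReal hfin]
    refine ⟨α, α u, hα, hαU, ⟨u, hu, rfl⟩, h1, ?_⟩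
    have h2 := hadd u hu
    rw [h1, hd.1, add_comm] at h2
    rw [ENNReal.ofReal_sub _ hr.le]
    exact ENNReal.eq_sub_of_add_eq ENNReal.ofReal_ne_top h2
  rcases hs with ⟨h1, h2⟩ | ⟨h1, h2⟩
  · obtain ⟨α, x, hα, hαU, hx, h3, h4⟩ := ivt ha hw hL h1 h2
    exact ⟨α, x, hαU, hx, Or.inl ⟨h1, h2, hα, h3, h4⟩⟩
  · obtain ⟨α, x, hα, hαU, hx, h3, h4⟩ := ivt hw ha hL.symm (r := s - L) (by linarith)
      (by linarith)
    refine ⟨α, x, hαU, hx, Or.inr ⟨h1, h2, hα, ?_, h3⟩⟩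
    rw [h4]; congr 1; ring

theorem hcos_comm (K b c a : ℝ) : hcos K b c a = hcos K c b a := by
  simp only [hcos]; ring

theorem hcos_neg (K b c a : ℝ) : hcos K b c (-a) = hcos K b c a := by
  simp only [hcos, md_neg]

theorem tendsto_hcos {ι : Type*} {l : Filter ι} {K b c a : ℝ} {f g h : ι → ℝ}
    (hf : Tendsto f l (𝓝 b)) (hg : Tendsto g l (𝓝 c)) (hh : Tendsto h l (𝓝 a))
    (hb : sn K b ≠ 0) (hc : sn K c ≠ 0) :
    Tendsto (fun i => hcos K (f i) (g i) (h i)) l (𝓝 (hcos K b c a)) := by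
  have m : ∀ {x : ℝ} {f : ι → ℝ}, Tendsto f l (𝓝 x) →
      Tendsto (fun i => md K (f i)) l (𝓝 (md K x)) := ((continuous_md K).tendsto _).comp
  have s : ∀ {x : ℝ} {f : ι → ℝ}, Tendsto f l (𝓝 x) →
      Tendsto (fun i => sn K (f i)) l (𝓝 (sn K x)) := ((continuous_sn K).tendsto _).comp
  exact ((((m hf).add (m hg)).add (((m hf).const_mul K).mul (m hg))).sub (m hh)).div
    ((s hf).mul (s hg)) (mul_ne_zero hb hc)

/-- The angle is the limit of the comparison angles, computed by the law of cosines. -/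
theorem AngleExists.exists_hcos_near {K : ℝ} {U V : Set X} (hV : IsSmall K U V) {α β : ℝ → X}
    (hex : AngleExists K α β) {ω : ℝ} (hω : angle K α β = ω) (h0 : α 0 ∈ V) {ε : ℝ}
    (hε : 0 < ε) :
    ∃ ρ > 0, ∀ s ∈ Ioo 0 ρ, ∀ r ∈ Ioo 0 ρ, α s ∈ V → β r ∈ V → sd (α 0) (α s) ≠ 0 →
      sd (α 0) (β r) ≠ 0 → sd (α s) (β r) ≠ 0 →
      |hcos K (sd (α 0) (α s)) (sd (α 0) (β r)) (sd (α s) (β r)) - Real.cosh ω| < ε := by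
  rw [AngleExists, hω, EReal.tendsto_coe] at hex
  have h1 := (Real.continuous_cosh.tendsto ω).comp hex
  have h2 := h1.eventually (Metric.ball_mem_nhds _ hε)
  -- The restriction of the filter becomes a premise, which `comparisonAngleDefined_of_SD`
  -- discharges for nondegenerate triangles in `V`.
  rw [angleFilter, eventually_inf_principal] at h2
  obtain ⟨P, hP, Q, hQ, hPQ⟩ := eventually_prod_iff.1 h2
  obtain ⟨ρ₁, hρ₁, h3⟩ := mem_nhdsGT_iff_exists_Ioo_subset.1 hP
  obtain ⟨ρ₂, hρ₂, h4⟩ := mem_nhdsGT_iff_exists_Ioo_subset.1 hQ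
  refine ⟨min ρ₁ ρ₂, lt_min hρ₁ hρ₂, fun s hs r hr hsV hrV n1 n2 n3 => ?_⟩
  have d1 := hV.SD_sd h0 hsV
  have d2 := hV.SD_sd h0 hrV
  have d3 := hV.SD_sd hsV hrV
  have l1 := hV.abs_sd_lt h0 hsV
  have l2 := hV.abs_sd_lt h0 hrV
  have l3 := hV.abs_sd_lt hsV hrV
  have := hPQ (h3 ⟨hs.1, hs.2.trans_le (min_le_left _ _)⟩)
    (h4 ⟨hr.1, hr.2.trans_le (min_le_right _ _)⟩)
    (comparisonAngleDefined_of_SD d1 d2 d3 n1 n2 n3 l1 l2 l3)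
  simp only [Function.comp_apply] at this
  rwa [cosh_comparisonAngle d1 d2 d3 n1 n2 n3 l1 l2 l3, Real.dist_eq] at this

end Local

/-! ### First order bounds and control of comparison angles by curvature. -/

section Variation

theorem md_sign_mul {ν : ℝ} (hν : ν = 1 ∨ ν = -1) (K s : ℝ) : md K (ν * s) = md K s := by
  rcases hν with rfl | rfl <;> simp [md_neg]

theorem sn_sign_mul {ν : ℝ} (hν : ν = 1 ∨ ν = -1) (K s : ℝ) : sn K (ν * s) = ν * sn K s := by
  rcases hν with rfl | rfl <;> simp [sn_neg]

theorem sign_mul_self {ν : ℝ} (hν : ν = 1 ∨ ν = -1) : ν * ν = 1 := by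
  rcases hν with rfl | rfl <;> simp

theorem abs_sign_mul {ν : ℝ} (hν : ν = 1 ∨ ν = -1) (s : ℝ) : |ν * s| = |s| := by
  rcases hν with rfl | rfl <;> simp

/-- The form of the law of cosines that fits the barrier lemmas: the coefficient `-ν * hcos K t (ν *
R) D` plays the role of the slope of the third side. -/
theorem md_eq_sign_hcos {ν : ℝ} (hν : ν = 1 ∨ ν = -1) {K t R : ℝ} (D : ℝ) (ht0 : 0 < t)
    (ht : t < lenBound K) (hR0 : 0 < R) (hR : R < lenBound K) :
    md K (ν * D) = md K R + md K t * (1 + K * md K R) +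
      sn K t * sn K R * (-ν * hcos K t (ν * R) D) := by
  have hν0 : ν ≠ 0 := by rcases hν with rfl | rfl <;> simp
  have h := md_eq_hcos (K := K) (b := t) (c := ν * R) (a := D) (by rwa [abs_of_pos ht0])
    (by rwa [abs_sign_mul hν, abs_of_pos hR0]) ht0.ne' (mul_ne_zero hν0 hR0.ne')
  rw [md_sign_mul hν, h, md_sign_mul hν, sn_sign_mul hν]
  ring

variable {X : Type*} [MetricSpace X] [LorentzianPreLengthSpace X]
  {K : ℝ} {U V : Set X} {a : X} {f : ℕ → X} {t : ℕ → ℝ} {ν : ℝ}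

/-- First order bounds on the separation of a point from points approaching `a`, in terms of the
comparison angles. -/
theorem IsSmall.eventually_sd_lt (hV : IsSmall K U V) (hU : IsComparisonDomain K U) (ha : a ∈ V)
    (hf : Tendsto f atTop (𝓝 a)) (ht : Tendsto t atTop (𝓝 0)) (ht0 : ∀ n, 0 < t n)
    (hν : ν = 1 ∨ ν = -1) {q : ℕ → X} {q₀ : X} (hq₀ : q₀ ∈ V) (hq : Tendsto q atTop (𝓝 q₀))
    (hR0 : 0 < ν * sd a q₀) {κ κ' : ℝ} (hκ : κ < κ')
    (h : ∀ᶠ n in atTop, -ν * hcos K (t n) (sd a (q n)) (sd (f n) (q n)) ≤ κ) :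
    ∀ᶠ n in atTop, ν * sd (f n) (q n) < ν * sd a (q n) + κ' * t n := by
  have hνν := sign_mul_self hν
  have hR : Tendsto (fun n => ν * sd a (q n)) atTop (𝓝 (ν * sd a q₀)) :=
    (hV.tendsto_sd hU ha hq₀ tendsto_const_nhds hq).const_mul ν
  have hlt : ν * sd a q₀ < lenBound K := by
    have := hV.abs_sd_lt ha hq₀
    rw [← abs_sign_mul hν] at this
    exact (le_abs_self _).trans_lt this
  refine eventually_lt_add_mul (K := K) hκ hR0 hlt hR ht (Eventually.of_forall ht0) ?_
  filter_upwards [h, hf.eventually (hV.isOpen.mem_nhds ha), hq.eventually (hV.isOpen.mem_nhds hq₀),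
    ht.eventually_lt_const (lenBound_pos K), hR.eventually_const_lt hR0,
    hR.eventually_lt_const hlt] with n hn hfn hqn htn h1 h2
  rw [abs_sign_mul hν]
  refine ⟨hV.abs_sd_lt hfn hqn, ?_⟩
  rw [md_eq_sign_hcos hν _ (ht0 n) htn h1 h2, ← mul_assoc ν ν, hνν, one_mul]
  have h3 := mul_pos (sn_pos (ht0 n) htn) (sn_pos h1 h2)
  nlinarith

theorem IsSmall.eventually_lt_sd (hV : IsSmall K U V) (hU : IsComparisonDomain K U) (ha : a ∈ V)
    (hf : Tendsto f atTop (𝓝 a)) (ht : Tendsto t atTop (𝓝 0)) (ht0 : ∀ n, 0 < t n)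
    (hν : ν = 1 ∨ ν = -1) {q : X} (hq : q ∈ V)
    (hR0 : 0 < ν * sd a q) {κ κ' : ℝ} (hκ : κ' < κ)
    (h : ∀ᶠ n in atTop, κ ≤ -ν * hcos K (t n) (sd a q) (sd (f n) q)) :
    ∀ᶠ n in atTop, ν * sd a q + κ' * t n < ν * sd (f n) q := by
  have hνν := sign_mul_self hν
  have hlt : ν * sd a q < lenBound K := by
    have := hV.abs_sd_lt ha hq
    rw [← abs_sign_mul hν] at this
    exact (le_abs_self _).trans_lt this
  have hA : Tendsto (fun n => ν * sd (f n) q) atTop (𝓝 (ν * sd a q)) :=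
    (hV.tendsto_sd hU ha hq hf tendsto_const_nhds).const_mul ν
  refine eventually_add_mul_lt (K := K) hκ hR0 hlt tendsto_const_nhds ht
    (Eventually.of_forall ht0) ?_
  filter_upwards [h, hf.eventually (hV.isOpen.mem_nhds ha),
    ht.eventually_lt_const (lenBound_pos K), hA.eventually_const_lt hR0] with n hn hfn htn h1
  refine ⟨h1.le, ?_⟩
  rw [md_eq_sign_hcos hν (sd (f n) q) (ht0 n) htn hR0 hlt, ← mul_assoc ν ν, hνν, one_mul]
  have h3 := mul_pos (sn_pos (ht0 n) htn) (sn_pos hR0 hlt)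
  nlinarith

theorem le_of_ofReal_le_tau {x y : X} {d : ℝ} (hxy : SD x y (sd x y)) (hd : 0 < d)
    (h : ENNReal.ofReal d ≤ tau x y) : d ≤ sd x y := by
  rw [hxy.1] at h
  exact ((ENNReal.ofReal_le_ofReal_iff' |>.1 h).resolve_right (by linarith))

theorem sd_le_of_tau_le_ofReal {x y : X} {d : ℝ} (hxy : SD x y (sd x y)) (hd : 0 < d)
    (h : tau x y ≤ ENNReal.ofReal d) : sd x y ≤ d := by
  rw [hxy.1] at h
  exact (ENNReal.ofReal_le_ofReal_iff hd.le).1 h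

/-- Monotonicity of comparison angles under a lower curvature bound. -/
theorem IsSmall.eventually_hcos_le_of_GE (hV : IsSmall K U V) (hU : IsComparisonDomain K U)
    (hT : TriangleComparison (fun r r' => r ≤ r') K U) (ha : a ∈ V)
    (hf : Tendsto f atTop (𝓝 a)) (ht : Tendsto t atTop (𝓝 0)) (ht0 : ∀ n, 0 < t n)
    (hν : ν = 1 ∨ ν = -1) {q : ℕ → X} {q₀ : X} (hq₀ : q₀ ∈ V) (hq : Tendsto q atTop (𝓝 q₀))
    (hR0 : 0 < ν * sd a q₀) {w : X} (hw : w ∈ V) {s : ℝ} (hs : 0 < s) (hsw : sd a w = s)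
    (hwq : sd w q₀ ≠ 0) {α : ℝ → X} (hα : ∀ᶠ n in atTop, OnSegment U α a w (f n) s (t n)) {κ : ℝ}
    (hκ : -ν * hcos K s (sd a q₀) (sd w q₀) < κ) :
    ∀ᶠ n in atTop, -ν * hcos K (t n) (sd a (q n)) (sd (f n) (q n)) ≤ κ := by
  have hνν := sign_mul_self hν
  have hsdq0 : sd a q₀ ≠ 0 := by rintro h0; simp [h0] at hR0
  have hq₀lt := hV.abs_sd_lt ha hq₀
  have hslt : s < lenBound K := by
    have := hV.abs_sd_lt ha hw
    rwa [hsw, abs_of_pos hs] at this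
  have haq := hV.tendsto_sd hU ha hq₀ tendsto_const_nhds hq
  have hfq := hV.tendsto_sd hU ha hq₀ hf hq
  have hwqn := hV.tendsto_sd hU hw hq₀ (tendsto_const_nhds (x := w)) hq
  have hR := haq.const_mul ν
  have hA := hfq.const_mul ν
  have hh := tendsto_hcos (K := K) (tendsto_const_nhds (x := s)) haq hwqn
    (sn_pos hs hslt).ne' (sn_ne_zero hq₀lt hsdq0)
  -- The expression is `md` of the model distance between the comparison points of `q n` and `f n`;
  -- its positive limit supplies the positivity needed for `hinge_comparison`.
  have hm : Tendsto (fun n => md K (sd a (q n)) + md K (t n) + K * md K (sd a (q n)) * md K (t n) -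
      sn K (sd a (q n)) * sn K (t n) * hcos K s (sd a (q n)) (sd w (q n))) atTop
      (𝓝 (md K (sd a q₀))) := by
    have m1 := ((continuous_md K).tendsto _).comp haq
    have m2 := ((continuous_md K).tendsto _).comp ht
    have s1 := ((continuous_sn K).tendsto _).comp haq
    have s2 := ((continuous_sn K).tendsto _).comp ht
    rw [md_zero] at m2
    rw [sn_zero] at s2
    have := ((m1.add m2).add ((m1.const_mul K).mul m2)).sub ((s1.mul s2).mul hh)
    simpa using this
  filter_upwards [hf.eventually (hV.isOpen.mem_nhds ha), hq.eventually (hV.isOpen.mem_nhds hq₀),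
    ht.eventually_lt_const (lenBound_pos K), hR.eventually_const_lt hR0,
    hA.eventually_const_lt hR0, hwqn.eventually_ne hwq, hα, hm.eventually_const_lt
      (md_pos hq₀lt hsdq0), ht.eventually_lt hR hR0, (hh.const_mul (-ν)).eventually_lt_const hκ]
    with n hfn hqn htn hRn hAn hwn hαn hmn htR hhn
  have hq0 : sd a (q n) ≠ 0 := by intro h0; simp [h0] at hRn
  have hqlt := hV.abs_sd_lt ha hqn
  have haqSD := hV.SD_sd ha hqn
  have hawSD := hV.SD_sd ha hw
  rw [hsw] at hawSD
  have hqwSD := (hV.SD_sd hw hqn).symm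
  -- The triangle is `a`, `q n`, `w`, with `f n` on its fixed side: the model length `d` uses the
  -- angle of this large triangle, and the true separation is at most `d`.
  obtain ⟨d, hd0, hdl, hd, hle1, hle2⟩ := hinge_comparison hU hT hV ha hqn hw haqSD hawSD hqwSD hq0
    hs.ne' (by simpa using hwn) hαn (by rwa [hcos_neg, hcos_comm])
  rw [hcos_neg, hcos_comm] at hd
  have hAd : ν * sd (f n) (q n) ≤ d := by
    rcases hν with rfl | rfl
    · rw [one_mul] at htR ⊢
      exact sd_le_of_tau_le_ofReal (hV.SD_sd hfn hqn) hd0 (hle2 htR)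
    · rw [neg_one_mul, ← sd_comm]
      exact sd_le_of_tau_le_ofReal (hV.SD_sd hqn hfn) hd0 (hle1 (by linarith [ht0 n]))
  have hmd : md K (ν * sd (f n) (q n)) ≤ md K d :=
    md_le_md (by rwa [abs_of_pos hd0]) (by rwa [abs_of_pos hd0, abs_of_pos hAn])
  have hRl : ν * sd a (q n) < lenBound K := by
    rw [← abs_sign_mul hν] at hqlt
    exact (le_abs_self _).trans_lt hqlt
  rw [md_eq_sign_hcos hν _ (ht0 n) htn hRn hRl, ← mul_assoc ν ν, hνν, one_mul, md_sign_mul hν,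
    sn_sign_mul hν, hd] at hmd
  have h3 := mul_pos (sn_pos (ht0 n) htn) (sn_pos hRn hRl)
  rw [sn_sign_mul hν] at h3
  refine le_trans ?_ hhn.le
  refine le_of_mul_le_mul_left ?_ h3
  have h4 : sn K (t n) * (ν * sn K (sd a (q n))) *
      (-ν * hcos K s (sd a (q n)) (sd w (q n))) = -(ν * ν) * (sn K (sd a (q n)) * sn K (t n) *
      hcos K s (sd a (q n)) (sd w (q n))) := by ring
  rw [h4, hνν]
  linarith

/-- Semicontinuity of angles under an upper curvature bound. -/
theorem IsSmall.eventually_hcos_le_of_LE (hV : IsSmall K U V) (hU : IsComparisonDomain K U)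
    (hT : TriangleComparison (fun r r' => r ≥ r') K U) (ha : a ∈ V)
    (hf : Tendsto f atTop (𝓝 a)) (ht : Tendsto t atTop (𝓝 0)) (ht0 : ∀ n, 0 < t n)
    (hft : ∀ n, sd a (f n) = t n)
    (hν : ν = 1 ∨ ν = -1) {q : ℕ → X} {q₀ : X} (hq₀ : q₀ ∈ V) (hq : Tendsto q atTop (𝓝 q₀))
    (hR0 : 0 < ν * sd a q₀) {y : X} (hy : y ∈ V) (hqy : 0 < ν * sd q₀ y)
    (hadd : sd a q₀ + sd q₀ y = sd a y) {κ κ' : ℝ} (hκ : κ < κ')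
    (h : ∀ᶠ n in atTop, -ν * hcos K (t n) (sd a y) (sd (f n) y) ≤ κ) :
    ∀ᶠ n in atTop, -ν * hcos K (t n) (sd a (q n)) (sd (f n) (q n)) ≤ κ' := by
  have hY0 : 0 < ν * sd a y := by rw [← hadd, mul_add]; linarith
  have hRY : ν * sd a q₀ < ν * sd a y := by rw [← hadd, mul_add]; linarith
  have hYlt : ν * sd a y < lenBound K := by
    have := hV.abs_sd_lt ha hy
    rw [← abs_sign_mul hν] at this
    exact (le_abs_self _).trans_lt this
  have hsdy0 : sd a y ≠ 0 := by rintro h0; simp [h0] at hY0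
  have hsdq0 : sd a q₀ ≠ 0 := by rintro h0; simp [h0] at hR0
  have haq := hV.tendsto_sd hU ha hq₀ tendsto_const_nhds hq
  have hfq := hV.tendsto_sd hU ha hq₀ hf hq
  have hyq := hV.tendsto_sd hU hy hq₀ (tendsto_const_nhds (x := y)) hq
  have hyq0 : ν * sd y q₀ < 0 := by rw [sd_comm]; linarith
  have hR := haq.const_mul ν
  have hA := hfq.const_mul ν
  have hE := (tendsto_hcos (K := K) (tendsto_const_nhds (x := sd a y)) haq hyq
    (sn_ne_zero (hV.abs_sd_lt ha hy) hsdy0) (sn_ne_zero (hV.abs_sd_lt ha hq₀) hsdq0)).neg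
  -- By `hadd` the triangle `a`, `q₀`, `y` is degenerate, so its angle at `a` vanishes.
  have hE1 : hcos K (sd a y) (sd a q₀) (sd y q₀) = 1 := by
    rw [hcos, show sd y q₀ = -(sd a y - sd a q₀) by rw [sd_comm y]; linarith, md_neg, md_sub]
    rw [div_eq_one_iff_eq (mul_ne_zero (sn_ne_zero (hV.abs_sd_lt ha hy) hsdy0)
      (sn_ne_zero (hV.abs_sd_lt ha hq₀) hsdq0))]
    ring
  rw [hE1] at hE
  refine eventually_le_of_shortcut (K := K) (Y := ν * sd a y) hκ hY0 hYlt
    (G := fun n => ν * sd (f n) y) (R := fun n => ν * sd a (q n)) hR0 hR ht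
    (Eventually.of_forall ht0) hE (fun κ'' hκ'' => hV.eventually_sd_lt hU ha hf ht ht0 hν hy
      tendsto_const_nhds hY0 hκ'' h) ?_
  filter_upwards [hf.eventually (hV.isOpen.mem_nhds ha), hq.eventually (hV.isOpen.mem_nhds hq₀),
    hR.eventually_const_lt hR0, hA.eventually_const_lt hR0, hR.eventually_lt_const hRY,
    (hyq.const_mul ν).eventually_lt_const hyq0] with n hfn hqn hRn hAn hRYn hyqn
  intro s hts hsR hm1 hm2
  have hs0 : 0 < s := (ht0 n).trans hts
  have hq0 : sd a (q n) ≠ 0 := by intro h0; simp [h0] at hRn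
  have hfq0 : sd (f n) (q n) ≠ 0 := by intro h0; simp [h0] at hAn
  have hyq0' : sd y (q n) ≠ 0 := by intro h0; simp [h0] at hyqn
  have haqSD := hV.SD_sd ha hqn
  have hafSD := hV.SD_sd ha hfn
  rw [hft] at hafSD
  -- One point `x` serves both hinges, with vertices `f n` and `y` opposite the common side from `a`
  -- to `q n`.
  obtain ⟨α, x, hx⟩ := exists_onSegment hU hV ha hqn haqSD (s := ν * s) (by
    rcases hν with rfl | rfl
    · left; constructor <;> linarith
    · right; constructor <;> linarith)
  have e1 : md K (t n) + md K (ν * s) + K * md K (t n) * md K (ν * s) - sn K (t n) * sn K (ν * s) *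
      hcos K (t n) (sd a (q n)) (sd (f n) (q n)) =
      md K (t n) + md K s * (1 + K * md K (t n)) + sn K (t n) * sn K s *
        (-ν * hcos K (t n) (sd a (q n)) (sd (f n) (q n))) := by
    rw [md_sign_mul hν, sn_sign_mul hν]; ring
  have e2 : md K (sd a y) + md K (ν * s) + K * md K (sd a y) * md K (ν * s) -
      sn K (sd a y) * sn K (ν * s) * hcos K (sd a y) (sd a (q n)) (sd y (q n)) =
      md K (ν * sd a y) + md K s * (1 + K * md K (ν * sd a y)) + sn K s * sn K (ν * sd a y) *
        (-hcos K (sd a y) (sd a (q n)) (sd y (q n))) := by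
    rw [md_sign_mul hν, sn_sign_mul hν, md_sign_mul hν, sn_sign_mul hν]; ring
  obtain ⟨d₁, hd₁0, hd₁l, hd₁, hf1, hf2⟩ := hinge_comparison hU hT hV ha hfn hqn hafSD haqSD
    (hV.SD_sd hfn hqn) (ht0 n).ne' hq0 hfq0 hx (by rwa [e1])
  obtain ⟨d₂, hd₂0, hd₂l, hd₂, hy1, hy2⟩ := hinge_comparison hU hT hV ha hy hqn (hV.SD_sd ha hy)
    haqSD (hV.SD_sd hy hqn) hsdy0 hq0 hyq0' hx (by rwa [e2])
  refine ⟨d₂, d₁, hd₂0.le, hd₁0.le, hd₁l, ?_, (hd₁.trans e1).ge, (hd₂.trans e2).ge⟩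
  -- The upper curvature bound makes the true separations at least `d₁` and `d₂`, and the reverse
  -- triangle inequality through `x` adds them.
  rcases hν with rfl | rfl
  · have h1 := hf1 (by linarith)
    have h2 := hy2 (by linarith)
    have c1 := tau_pos_iff.1 ((ENNReal.ofReal_pos.2 hd₁0).trans_le h1)
    have c2 := tau_pos_iff.1 ((ENNReal.ofReal_pos.2 hd₂0).trans_le h2)
    rw [one_mul, add_comm]
    refine le_of_ofReal_le_tau (hV.SD_sd hfn hy) (by linarith) ?_
    rw [ENNReal.ofReal_add hd₁0.le hd₂0.le]
    exact (add_le_add h1 h2).trans (tau_add_le c1.caus c2.caus)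
  · have h1 := hf2 (by linarith [ht0 n])
    have h2 := hy1 (by linarith)
    have c1 := tau_pos_iff.1 ((ENNReal.ofReal_pos.2 hd₁0).trans_le h1)
    have c2 := tau_pos_iff.1 ((ENNReal.ofReal_pos.2 hd₂0).trans_le h2)
    rw [neg_one_mul, ← sd_comm]
    refine le_of_ofReal_le_tau (hV.SD_sd hy hfn) (by linarith) ?_
    rw [ENNReal.ofReal_add hd₂0.le hd₁0.le]
    exact (add_le_add h2 h1).trans (tau_add_le c2.caus c1.caus)

end Variation

/-! ### Separations and geodesics in the time direction of `p`. -/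

section FirstVariation

variable {X : Type*} [MetricSpace X] [LorentzianPreLengthSpace X]

open Classical in
/-- The time separation in the direction `ν`, from `x` to `y` if `ν = 1`, from `y` to `x`
otherwise. -/
noncomputable def dirTau (ν : ℝ) (x y : X) : ℝ≥0∞ := if ν = 1 then tau x y else tau y x

theorem dirTau_one (x y : X) : dirTau 1 x y = tau x y := by simp [dirTau]

theorem dirTau_neg_one (x y : X) : dirTau (-1) x y = tau y x := by
  rw [dirTau, if_neg (by norm_num)]

variable {ν : ℝ}

theorem dirTau_add_le (hν : ν = 1 ∨ ν = -1) {x y z : X} (h : 0 < dirTau ν x y)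
    (h' : 0 < dirTau ν y z) : dirTau ν x y + dirTau ν y z ≤ dirTau ν x z := by
  rcases hν with rfl | rfl
  · simp only [dirTau_one] at *
    exact tau_add_le (tau_pos_iff.1 h).caus (tau_pos_iff.1 h').caus
  · simp only [dirTau_neg_one] at *
    rw [add_comm]
    exact tau_add_le (tau_pos_iff.1 h').caus (tau_pos_iff.1 h).caus

theorem IsSmall.dirTau_eq {K : ℝ} {U V : Set X} (hV : IsSmall K U V) (hν : ν = 1 ∨ ν = -1)
    {x y : X} (hx : x ∈ V) (hy : y ∈ V) : dirTau ν x y = ENNReal.ofReal (ν * sd x y) := by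
  have h := hV.SD_sd hx hy
  rcases hν with rfl | rfl
  · rw [dirTau_one, one_mul, h.1]
  · rw [dirTau_neg_one, neg_one_mul, h.2]

theorem tau_eq_zero_of_chron' {x y : X} (h : Chron x y) (hy : tau y y = 0) : tau y x = 0 := by
  by_contra h0
  have hc := tau_pos_iff.1 (pos_iff_ne_zero.2 h0)
  have := tau_pos_iff.2 (hc.trans h)
  rw [hy] at this
  exact lt_irrefl _ this

theorem tauS_eq_dirTau (hν : ν = 1 ∨ ν = -1) {p z : X} (hz : tau z z = 0)
    (h : 0 < dirTau ν z p) : tauS p z = dirTau ν z p := by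
  rcases hν with rfl | rfl
  · rw [dirTau_one] at h ⊢
    rw [tauS, tau_eq_zero_of_chron (tau_pos_iff.1 h) hz, max_eq_right (zero_le)]
  · rw [dirTau_neg_one] at h ⊢
    rw [tauS, tau_eq_zero_of_chron' (tau_pos_iff.1 h) hz, max_eq_left (zero_le)]

/-- `β`, traversed from `1` to `0`, is a timelike geodesic in the time direction `ν`. -/
def IsDirectedGeodesic (ν : ℝ) (β : ℝ → X) : Prop :=
  (ν = 1 ∧ IsFutureTimelikeGeodesic (fun s => β (0 + 1 - s)) 0 1) ∨
    (ν = -1 ∧ IsFutureTimelikeGeodesic β 0 1)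

theorem IsFutureGeodesic.mono {α : ℝ → X} {c d c' d' : ℝ} (h : IsFutureGeodesic α c d)
    (hs : Icc c' d' ⊆ Icc c d) : IsFutureGeodesic α c' d' :=
  ⟨⟨h.1.1.mono hs, fun s h1 t h2 => h.1.2 s (hs h1) t (hs h2)⟩,
    fun s h1 t h2 => h.2 s (hs h1) t (hs h2)⟩

namespace IsDirectedGeodesic

variable {β : ℝ → X}

theorem dirTau_pos (h : IsDirectedGeodesic ν β) {r r' : ℝ} (h0 : 0 ≤ r) (hr : r < r')
    (h1 : r' ≤ 1) : 0 < dirTau ν (β (1 - r)) (β (1 - r')) := by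
  rcases h with ⟨rfl, h⟩ | ⟨rfl, h⟩
  · have := h.2 r ⟨h0, by linarith⟩ r' ⟨by linarith, h1⟩ hr
    rw [dirTau_one, tau_pos_iff]
    simpa using this
  · rw [dirTau_neg_one, tau_pos_iff]
    exact h.2 (1 - r') ⟨by linarith, by linarith⟩ (1 - r) ⟨by linarith, by linarith⟩ (by linarith)

theorem dirTau_add (h : IsDirectedGeodesic ν β) {r r' r'' : ℝ} (h0 : 0 ≤ r) (hr : r ≤ r')
    (hr' : r' ≤ r'') (h1 : r'' ≤ 1) :
    dirTau ν (β (1 - r)) (β (1 - r')) + dirTau ν (β (1 - r')) (β (1 - r'')) =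
      dirTau ν (β (1 - r)) (β (1 - r'')) := by
  rcases h with ⟨rfl, h⟩ | ⟨rfl, h⟩
  · have := (h.1.mono (Icc_subset_Icc h0 h1)).tau_add (s := r') ⟨hr, hr'⟩
    simp only [dirTau_one]
    simpa using this
  · have := (h.1.mono (Icc_subset_Icc (show 0 ≤ 1 - r'' by linarith)
      (show 1 - r ≤ 1 by linarith))).tau_add (s := 1 - r') ⟨by linarith, by linarith⟩
    simp only [dirTau_neg_one]
    rw [add_comm]
    exact this

theorem continuousOn (h : IsDirectedGeodesic ν β) :
    ContinuousOn (fun r => β (1 - r)) (Icc 0 1) := by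
  rcases h with ⟨-, h⟩ | ⟨-, h⟩
  · have := h.1.1.1
    simpa using this
  · exact h.1.1.1.comp (by fun_prop) fun r hr => ⟨by linarith [hr.2], by linarith [hr.1]⟩

end IsDirectedGeodesic

/-- A timelike geodesic of the wrong orientation would relate its endpoints in the excluded
direction. -/
theorem IsTimelikeGeodesic.isDirectedGeodesic (hν : ν = 1 ∨ ν = -1) {β : ℝ → X}
    (h : IsTimelikeGeodesic β 0 1) (h' : ¬ 0 < dirTau ν (β 0) (β 1)) : IsDirectedGeodesic ν β := by
  rcases h with h | h <;> rcases hν with rfl | rfl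
  · refine absurd ?_ h'
    rw [dirTau_one, tau_pos_iff]
    exact h.2 0 (by simp) 1 (by simp) one_pos
  · exact Or.inr ⟨rfl, h⟩
  · exact Or.inl ⟨rfl, h⟩
  · refine absurd ?_ h'
    rw [dirTau_neg_one, tau_pos_iff]
    have := h.2 0 (by simp) 1 (by simp) one_pos
    simpa using this

end FirstVariation

end LorentzPL

/-! ### The first variation formula. -/

theorem theorem3p6 {X : Type*} [MetricSpace X] [LorentzianPreLengthSpace X]
    (hsc : StronglyCausal X) (hcc : LocallyCausallyClosed X) (hreg : Regular X)
    (K : ℝ) (U : Set X) (hU : IsComparisonNhdLE K U ∨ IsComparisonNhdGE K U)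
    (δ : ℝ) (hδ : 0 < δ) (γ : ℝ → X) (hγ : IsFutureTimelikeGeodesic γ 0 δ)
    (hγτ : ∀ s ∈ Icc 0 δ, ∀ t ∈ Icc 0 δ, s ≤ t → tau (γ s) (γ t) = ENNReal.ofReal (t - s))
    (hγU : ∀ s ∈ Icc 0 δ, γ s ∈ U)
    (p : X) (σ : ℝ) (hσ : (Chron p (γ 0) ∧ σ = 1) ∨ (Chron (γ 0) p ∧ σ = -1))
    (hp : tauS p (γ 0) ≠ ⊤)
    (t : ℕ → ℝ) (ht : ∀ n, 0 < t n ∧ t n ≤ δ) (ht0 : Tendsto t atTop (𝓝 0))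
    (β : ℕ → ℝ → X)
    (hβ : ∀ n, IsTimelikeGeodesic (β n) 0 1 ∧ β n 0 = p ∧ β n 1 = γ (t n))
    (β₀ : ℝ → X) (hβ₀ : IsTimelikeGeodesic β₀ 0 1 ∧ β₀ 0 = p ∧ β₀ 1 = γ 0)
    (hlim : TendstoUniformlyOn β β₀ atTop (Icc 0 1))
    (hex : AngleExists K γ (fun s => β₀ (1 - s)))
    (hfin : signedAngle K γ (fun s => β₀ (1 - s)) ≠ ⊤ ∧
      signedAngle K γ (fun s => β₀ (1 - s)) ≠ ⊥) :
    (∀ᶠ n in atTop, tauS p (γ (t n)) ≠ ⊤) ∧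
      Tendsto (fun n => ((tauS p (γ (t n))).toReal - (tauS p (γ 0)).toReal) / t n) atTop
        (𝓝 (σ * Real.cosh (angle K γ (fun s => β₀ (1 - s))).toReal)) := by
  obtain ⟨hdom, hT⟩ : IsComparisonDomain K U ∧
      (TriangleComparison (fun r r' => r ≥ r') K U ∨
        TriangleComparison (fun r r' => r ≤ r') K U) := by
    rcases hU with h | h
    · exact ⟨h.1, Or.inl h.2⟩
    · exact ⟨h.1, Or.inr h.2⟩
  have h0δ : (0 : ℝ) ∈ Icc 0 δ := ⟨le_rfl, hδ.le⟩
  have hcurve := hγ.1.1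
  have hself : tau (γ 0) (γ 0) = 0 := by
    rw [hγτ 0 h0δ 0 h0δ le_rfl]; simp
  obtain ⟨V, hV, ha⟩ := exists_isSmall hdom (hγU 0 h0δ) hself
  have hnear := hV.isOpen.mem_nhds ha
  have hγs : ∀ s ∈ Icc 0 δ, 0 < s → SD (γ 0) (γ s) s := by
    intro s hs hs0
    have h1 := hγτ 0 h0δ s hs hs.1
    rw [sub_zero] at h1
    refine ⟨h1, ?_⟩
    rw [tau_eq_zero_of_chron (hγ.2 0 h0δ s hs hs0) hself, ENNReal.ofReal_of_nonpos (by linarith)]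
  have htδ : ∀ n, t n ∈ Icc 0 δ := fun n => ⟨(ht n).1.le, (ht n).2⟩
  have ht0' : ∀ n, 0 < t n := fun n => (ht n).1
  have hf : Tendsto (fun n => γ (t n)) atTop (𝓝 (γ 0)) :=
    (hcurve.1 0 h0δ).tendsto.comp
      (tendsto_nhdsWithin_iff.2 ⟨ht0, Eventually.of_forall htδ⟩)
  have hft : ∀ n, sd (γ 0) (γ (t n)) = t n := fun n => (hγs _ (htδ n) (ht0' n)).sd_eq
  obtain ⟨ν, hσν, hν, hpa⟩ : ∃ ν : ℝ, σ = -ν ∧ (ν = 1 ∨ ν = -1) ∧ 0 < dirTau ν (γ 0) p := by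
    rcases hσ with ⟨h, rfl⟩ | ⟨h, rfl⟩
    · exact ⟨-1, by simp, by simp, by rw [dirTau_neg_one]; exact tau_pos_iff.2 h⟩
    · exact ⟨1, by simp, by simp, by rw [dirTau_one]; exact tau_pos_iff.2 h⟩
  subst hσν
  obtain ⟨hβ₀g, hβ₀0, hβ₀1⟩ := hβ₀
  have hdir₀ : IsDirectedGeodesic ν β₀ := by
    -- Otherwise `a` would precede `p` and `p` precede `a` in direction `ν`, contradicting `tau a a
    -- = 0`.
    refine hβ₀g.isDirectedGeodesic hν fun hc => ?_
    rw [hβ₀0, hβ₀1] at hc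
    have h1 := dirTau_add_le hν hpa hc
    have h2 : dirTau ν (γ 0) (γ 0) = 0 := by rw [dirTau]; split_ifs <;> exact hself
    rw [h2] at h1
    exact hpa.ne' (le_antisymm (le_self_add.trans h1) zero_le)
  have hdir : ∀ᶠ n in atTop, IsDirectedGeodesic ν (β n) := by
    have hlim0 : Tendsto (fun n => ENNReal.ofReal (t n)) atTop (𝓝 0) := by
      have h1 := (ENNReal.continuous_ofReal.tendsto 0).comp ht0
      rwa [ENNReal.ofReal_zero] at h1
    -- With the wrong orientation `p` would lie between `a` and `γ (t n)`, whose separation is only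
    -- `t n`; this fails once `t n` is below the separation of `a` and `p`.
    filter_upwards [hlim0.eventually_lt_const hpa] with n hn
    obtain ⟨hβg, hβ0, hβ1⟩ := hβ n
    refine hβg.isDirectedGeodesic hν fun hc => ?_
    rw [hβ0, hβ1] at hc
    have h1 := dirTau_add_le hν hpa hc
    have h2 : dirTau ν (γ 0) (γ (t n)) ≤ ENNReal.ofReal (t n) := by
      have := hγs _ (htδ n) (ht0' n)
      rw [dirTau]
      split_ifs
      · exact this.1.le
      · rw [this.2]; exact ENNReal.ofReal_le_ofReal (by linarith [ht0' n])
    exact absurd (le_self_add.trans (h1.trans h2)) (not_le.2 hn)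
  have hl0 : tauS p (γ 0) = dirTau ν (γ 0) p := tauS_eq_dirTau hν hself hpa
  rw [hl0] at hp ⊢
  obtain ⟨ω, hω⟩ : ∃ ω : ℝ, angle K γ (fun s => β₀ (1 - s)) = ω := by
    have h1 : angle K γ (fun s => β₀ (1 - s)) ≠ ⊤ ∧ angle K γ (fun s => β₀ (1 - s)) ≠ ⊥ := by
      rw [signedAngle] at hfin
      split_ifs at hfin
      · rw [Ne, Ne, EReal.neg_eq_top_iff, EReal.neg_eq_bot_iff] at hfin
        exact hfin.symm
      · exact hfin
    exact ⟨_, (EReal.coe_toReal h1.1 h1.2).symm⟩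
  rw [hω, EReal.toReal_coe]
  have hb0 : Tendsto (fun r => β₀ (1 - r)) (𝓝[>] 0) (𝓝 (γ 0)) := by
    have h1 := (hdir₀.continuousOn 0 (by simp)).tendsto
    simp only [sub_zero, hβ₀1] at h1
    refine h1.mono_left ?_
    rw [← nhdsWithin_Ioc_eq_nhdsGT zero_lt_one]
    exact nhdsWithin_mono _ Ioc_subset_Icc_self
  have key : ∀ ε > 0, ∀ᶠ n in atTop, tauS p (γ (t n)) ≠ ⊤ ∧
      (-ν * Real.cosh ω - ε) * t n <
        (tauS p (γ (t n))).toReal - (dirTau ν (γ 0) p).toReal ∧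
      (tauS p (γ (t n))).toReal - (dirTau ν (γ 0) p).toReal <
        (-ν * Real.cosh ω + ε) * t n := by
    intro ε hε
    obtain ⟨ρ, hρ, hang⟩ := hex.exists_hcos_near hV hω ha (ε := ε / 3) (by positivity)
    obtain ⟨r', hr'0, hr'1, hr'V⟩ : ∃ r', 0 < r' ∧ r' < min ρ 1 ∧
        ∀ r ∈ Ioc 0 r', β₀ (1 - r) ∈ V := by
      obtain ⟨u, hu, hu'⟩ := mem_nhdsGT_iff_exists_Ioo_subset.1 (hb0.eventually hnear)
      have hu : 0 < u := hu
      have h1 : 0 < min u (min ρ 1) := by positivity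
      refine ⟨min u (min ρ 1) / 2, by positivity, ?_, fun r hr => hu' ⟨hr.1, ?_⟩⟩
      · linarith [min_le_right u (min ρ 1)]
      · linarith [hr.2, min_le_left u (min ρ 1)]
    have hr'ρ : r' < ρ := hr'1.trans_le (min_le_left _ _)
    have hr'1 : r' < 1 := hr'1.trans_le (min_le_right _ _)
    -- Taking `q` strictly between `a` and `y` leaves a piece of `β₀` beyond `q`, which the upper
    -- curvature bound requires.
    set r := r' / 2 with hr
    have hr0 : 0 < r := by positivity
    have hrr' : r < r' := by linarith
    set q := β₀ (1 - r) with hq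
    set y := β₀ (1 - r') with hy
    have hqV : q ∈ V := hr'V r ⟨hr0, hrr'.le⟩
    have hyV : y ∈ V := hr'V r' ⟨hr'0, le_rfl⟩
    have hpos : ∀ {x z : X}, x ∈ V → z ∈ V → (0 < dirTau ν x z ↔ 0 < ν * sd x z) := by
      intro x z hx hz
      rw [hV.dirTau_eq hν hx hz, ENNReal.ofReal_pos]
    have e0 : β₀ (1 - 0) = γ 0 := by rw [sub_zero, hβ₀1]
    have hTaq : 0 < dirTau ν (γ 0) q := by
      rw [← e0]; exact hdir₀.dirTau_pos le_rfl hr0 (by linarith)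
    have hTay : 0 < dirTau ν (γ 0) y := by
      rw [← e0]; exact hdir₀.dirTau_pos le_rfl hr'0 hr'1.le
    have hTqy : 0 < dirTau ν q y := hdir₀.dirTau_pos hr0.le hrr' hr'1.le
    have haq := (hpos ha hqV).1 hTaq
    have hay := (hpos ha hyV).1 hTay
    have hqy := (hpos hqV hyV).1 hTqy
    have hadd : sd (γ 0) q + sd q y = sd (γ 0) y := by
      have h1 := hdir₀.dirTau_add le_rfl hr0.le hrr'.le hr'1.le
      rw [e0, hV.dirTau_eq hν ha hqV, hV.dirTau_eq hν hqV hyV, hV.dirTau_eq hν ha hyV,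
        ← ENNReal.ofReal_add haq.le hqy.le,
        ENNReal.ofReal_eq_ofReal_iff (by linarith) hay.le, ← mul_add] at h1
      exact mul_left_cancel₀ (by rcases hν with rfl | rfl <;> norm_num) h1
    have hang' : ∀ z : X, (∃ r ∈ Ioo 0 ρ, z = β₀ (1 - r)) → z ∈ V → 0 < ν * sd (γ 0) z →
        ∀ᶠ n in atTop, |-ν * hcos K (t n) (sd (γ 0) z) (sd (γ (t n)) z) - -ν * Real.cosh ω| <
          ε / 3 := by
      rintro z ⟨r, hr, rfl⟩ hz hz0
      have h1 := hV.tendsto_sd hdom ha hz hf (tendsto_const_nhds (x := β₀ (1 - r)))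
      have hz0 : sd (γ 0) (β₀ (1 - r)) ≠ 0 := by intro h; simp [h] at hz0
      filter_upwards [h1.eventually_ne hz0, hf.eventually hnear, ht0.eventually_lt_const hρ]
        with n hn hfn htn
      have h2 := hang (t n) ⟨ht0' n, htn⟩ r hr hfn hz (by rw [hft]; exact (ht0' n).ne') hz0 hn
      rw [hft] at h2
      rw [← mul_sub, abs_mul, abs_neg]
      rcases hν with rfl | rfl <;> simpa using h2
    have hangq := hang' q ⟨r, ⟨hr0, by linarith⟩, rfl⟩ hqV haq
    have hangy := hang' y ⟨r', ⟨hr'0, hr'ρ⟩, rfl⟩ hyV hay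
    have hlow := hV.eventually_lt_sd hdom ha hf ht0 ht0' hν hqV haq
      (κ := -ν * Real.cosh ω - ε / 3) (κ' := -ν * Real.cosh ω - ε) (by linarith)
      (hangq.mono fun n hn => by linarith [(abs_lt.1 hn).1])
    have hqn : Tendsto (fun n => β n (1 - r)) atTop (𝓝 q) :=
      hlim.tendsto_at ⟨by linarith, by linarith⟩
    -- The error is split: `ε / 3` for the angle at a fixed point, another `ε / 3` for passing to
    -- the moving point, the rest for the first order expansion.
    have hup : ∀ᶠ n in atTop, -ν * hcos K (t n) (sd (γ 0) (β n (1 - r)))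
        (sd (γ (t n)) (β n (1 - r))) ≤ -ν * Real.cosh ω + 2 * ε / 3 := by
      rcases hT with hT | hT
      · exact hV.eventually_hcos_le_of_LE hdom hT ha hf ht0 ht0' hft hν hqV hqn haq hyV hqy hadd
          (κ := -ν * Real.cosh ω + ε / 3) (by linarith)
          (hangy.mono fun n hn => by linarith [(abs_lt.1 hn).2])
      · have h1 := hV.tendsto_sd hdom ha hqV hf (tendsto_const_nhds (x := q))
        have haq0 : sd (γ 0) q ≠ 0 := by intro h; simp [h] at haq
        -- `γ (t m)` is the fixed vertex of the large triangle; its angle with `q` is already close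
        -- to the limit.
        obtain ⟨m, hm1, hm2, hm3⟩ :=
          ((h1.eventually_ne haq0).and ((hf.eventually hnear).and hangq)).exists
        refine hV.eventually_hcos_le_of_GE hdom hT ha hf ht0 ht0' hν hqV hqn haq hm2 (ht0' m)
          (hft m) hm1 (α := fun u => γ (t m * u)) ?_ (by linarith [(abs_lt.1 hm3).2])
        filter_upwards [ht0.eventually_lt_const (ht0' m)] with n hn
        exact onSegment_of_unit_speed hcurve hγτ hγU (ht0' n) hn (ht m).2
    have hupper := hV.eventually_sd_lt hdom ha hf ht0 ht0' hν hqV hqn haq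
      (κ' := -ν * Real.cosh ω + ε) (by linarith) hup
    have l1 := (hV.tendsto_sd hdom ha hqV (tendsto_const_nhds (x := γ 0)) hqn).const_mul ν
    have l2 := (hV.tendsto_sd hdom ha hqV hf hqn).const_mul ν
    have l3 := (hV.tendsto_sd hdom ha hqV hf (tendsto_const_nhds (x := q))).const_mul ν
    filter_upwards [hdir, hlow, hupper, hf.eventually hnear,
      hqn.eventually (hV.isOpen.mem_nhds hqV), l1.eventually_const_lt haq,
      l2.eventually_const_lt haq, l3.eventually_const_lt haq] with n hd hlo hup hfn hqnV p1 p2 p3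
    obtain ⟨-, hβ0, hβ1⟩ := hβ n
    set z := γ (t n)
    set w := β n (1 - r)
    have en : β n (1 - 0) = z := by rw [sub_zero, hβ1]
    have en1 : β n (1 - 1) = p := by rw [sub_self, hβ0]
    have e1 : β₀ (1 - 1) = p := by rw [sub_self, hβ₀0]
    have hwp : 0 < dirTau ν w p := by
      rw [← en1]; exact hd.dirTau_pos hr0.le (by linarith) le_rfl
    have hqp : 0 < dirTau ν q p := by
      rw [← e1]; exact hdir₀.dirTau_pos hr0.le (by linarith) le_rfl
    have i1 : dirTau ν z w + dirTau ν w p = dirTau ν z p := by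
      have := hd.dirTau_add le_rfl hr0.le (show r ≤ 1 by linarith) le_rfl
      rwa [en, en1] at this
    have i2 : dirTau ν (γ 0) q + dirTau ν q p = dirTau ν (γ 0) p := by
      have := hdir₀.dirTau_add le_rfl hr0.le (show r ≤ 1 by linarith) le_rfl
      rwa [e0, e1] at this
    -- Together with `i1` this gives the upper bound for the difference quotient, the term `dirTau ν
    -- w p` cancelling. `i2` and `i4` give the lower bound in the same way.
    have i3 : dirTau ν (γ 0) w + dirTau ν w p ≤ dirTau ν (γ 0) p :=
      dirTau_add_le hν ((hpos ha hqnV).2 p1) hwp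
    have i4 : dirTau ν z q + dirTau ν q p ≤ dirTau ν z p :=
      dirTau_add_le hν ((hpos hfn hqV).2 p3) hqp
    -- Finiteness at `a` passes to `w` by `i3`, and from `w` to `z` by the equality `i1`.
    have hwfin : dirTau ν w p ≠ ⊤ := ne_top_of_le_ne_top hp (le_add_self.trans i3)
    have hqfin : dirTau ν q p ≠ ⊤ := ne_top_of_le_ne_top hp (i2 ▸ le_add_self)
    rw [hV.dirTau_eq hν hfn hqnV] at i1
    rw [hV.dirTau_eq hν ha hqV] at i2
    rw [hV.dirTau_eq hν ha hqnV] at i3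
    rw [hV.dirTau_eq hν hfn hqV] at i4
    have hzp : 0 < dirTau ν z p := by rw [← i1]; exact hwp.trans_le le_add_self
    have hfin : dirTau ν z p ≠ ⊤ := by
      rw [← i1]; exact ENNReal.add_ne_top.2 ⟨ENNReal.ofReal_ne_top, hwfin⟩
    rw [tauS_eq_dirTau hν (hV.tau_self hfn) hzp]
    have j1 := congrArg ENNReal.toReal i1
    have j2 := congrArg ENNReal.toReal i2
    have j3 := ENNReal.toReal_mono hp i3
    have j4 := ENNReal.toReal_mono hfin i4
    rw [ENNReal.toReal_add ENNReal.ofReal_ne_top hwfin, ENNReal.toReal_ofReal (by linarith)]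
      at j1 j3
    rw [ENNReal.toReal_add ENNReal.ofReal_ne_top hqfin, ENNReal.toReal_ofReal (by linarith)]
      at j2 j4
    exact ⟨hfin, by linarith, by linarith⟩
  refine ⟨(key 1 one_pos).mono fun n hn => hn.1, Metric.tendsto_nhds.2 fun ε hε => ?_⟩
  filter_upwards [key ε hε] with n hn
  rw [Real.dist_eq, abs_lt]
  constructor
  · rw [lt_sub_iff_add_lt, lt_div_iff₀ (ht0' n)]
    linarith [hn.2.1]
  · rw [sub_lt_iff_lt_add, div_lt_iff₀ (ht0' n)]
    linarith [hn.2.2]
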